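/- All graphs are finite and simple; $v(G)$ and $e(G)$ denote the numbers of vertices and edges of $G$, and $\sqcup$ denotes disjoint union. A \emph{graphon} is a symmetric measurable function $W:[0,1]^2\to[0,1]$, and the homomorphism density of a graph $G$ in $W$ is \[t(G,W)=\int_{[0,1]^{V(G)}}\prod_{uv\in E(G)}W(x_u,x_v)\,\prod_{v\in V(G)}dx_v .\] A graph $G$ is \emph{common} if $\inf_W\bigl(t(G,W)+t(G,1-W)\bigr)=2(1/2)^{e(G)}$, the infimum being over all graphons $W$. A graph $G$ with at least one edge is \emph{Sidorenko} if $t(G,W)\ge t(K_2,W)^{e(G)}$ for every graphon $W$. A \emph{$K_3$-tree} is a pair $(T,\varphi)$, where $T$ is a tree and $\varphi:V(T)\cup E(T)\to 2^{V(K_3)}$ satisfies $\varphi(st)\subsetneq\varphi(s)\cap\varphi(t)$ for every $st\in E(T)$. The graph $H(T,\varphi)$ is obtained from pairwise disjoint copies $J_t$ of the induced subgraphs $K_3[\varphi(t)]$, $t\in V(T)$, by identifying, for every $st\in E(T)$ and every $w\in\varphi(st)$, the vertex of $J_s$ corresponding to $w$ with the vertex of $J_t$ corresponding to $w$. Let $v_j=v_j(T,\varphi)$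 be the number of $t\in V(T)$ with $|\varphi(t)|=j$, and let $e_j=e_j(T,\varphi)$ be the number of $e\in E(T)$ with $|\varphi(e)|=j$. \textbf{Statement.} Let $(T,\varphi)$ be a $K_3$-tree with $e_2\ge v_2$, let $H=H(T,\varphi)$, and let $F$ be a Sidorenko graph. (a) If $v_3=k\ge 3$ and $e(F)\le \frac{5k}{3}+e_2-v_2$, then $H\sqcup F$ is common. (b) If $v_3=2$ and $e(F)\le 2+e_2-v_2$, then $H\sqcup F$ is common. -/

import Mathlib

open MeasureTheory

/-- A graphon: a symmetric measurable function `[0,1]² → [0,1]`. -/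
structure Graphon where
  toFun : unitInterval → unitInterval → ℝ
  measurable' : Measurable (Function.uncurry toFun)
  symm' : ∀ x y, toFun x y = toFun y x
  nonneg' : ∀ x y, 0 ≤ toFun x y
  le_one' : ∀ x y, toFun x y ≤ 1

namespace Graphon

/-- The complementary graphon `1 - W`. -/
def compl (W : Graphon) : Graphon where
  toFun x y := 1 - W.toFun x y
  measurable' := W.measurable'.const_sub 1
  symm' x y := by rw [W.symm' x y]
  nonneg' x y := sub_nonneg.2 (W.le_one' x y)
  le_one' x y := sub_le_self 1 (W.nonneg' x y)

/-- The value `W(x, y)` as a function of the unordered pair `{x, y}`. -/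
def onPair (W : Graphon) : Sym2 unitInterval → ℝ :=
  Sym2.lift ⟨W.toFun, W.symm'⟩

end Graphon

/-- The number of edges `e(H)` of a (finite) graph. -/
noncomputable def numEdges {V : Type*} (H : SimpleGraph V) : ℕ :=
  H.edgeSet.ncard

open Classical in
/-- The homomorphism density `t(H, W) = ∫_{[0,1]^{V(H)}} ∏_{uv ∈ E(H)} W(x_u, x_v) dx`. -/
noncomputable def homDensity {V : Type*} [Fintype V] (H : SimpleGraph V) (W : Graphon) : ℝ :=
  ∫ x : V → unitInterval, ∏ e ∈ H.edgeFinset, W.onPair (e.map x)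

/-- The Ramsey multiplicity constant `c(H) = inf_W (t(H, W) + t(H, 1 - W))`. -/
noncomputable def ramseyMultiplicity {V : Type*} [Fintype V] (H : SimpleGraph V) : ℝ :=
  ⨅ W : Graphon, (homDensity H W + homDensity H W.compl)

/-- `H` is common if `c(H) = 2 (1/2)^{e(H)}`. -/
def IsCommon {V : Type*} [Fintype V] (H : SimpleGraph V) : Prop :=
  ramseyMultiplicity H = 2 * (1 / 2 : ℝ) ^ numEdges H

/-- A graph `H` with at least one edge is Sidorenko if `t(H, W) ≥ t(K₂, W)^{e(H)}` for every
graphon `W`. -/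
def IsSidorenko {V : Type*} [Fintype V] (H : SimpleGraph V) : Prop :=
  H.edgeSet.Nonempty ∧
    ∀ W : Graphon, homDensity (⊤ : SimpleGraph (Fin 2)) W ^ numEdges H ≤ homDensity H W

/-- An `F`-tree `(T, φ)`: `T` is a tree and `φ` maps vertices and edges of `T` to subsets of `V(F)`
so that `φ(st)` is a proper subset of `φ(s) ∩ φ(t)` for every edge `st` of `T`. The map `φ` is given
by its restrictions `onVertex` and `onEdge` to the vertices and to the edges. -/
structure FTree {U : Type*} [DecidableEq U] (F : SimpleGraph U) {τ : Type*}
    (T : SimpleGraph τ) where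
  isTree : T.IsTree
  onVertex : τ → Finset U
  onEdge : T.edgeSet → Finset U
  ssubset : ∀ (s t : τ) (h : T.Adj s t),
    onEdge ⟨s(s, t), T.mem_edgeSet.2 h⟩ ⊂ onVertex s ∩ onVertex t

namespace FTree

variable {U : Type*} [DecidableEq U] {F : SimpleGraph U} {τ : Type*} {T : SimpleGraph τ}

/-- The number `v_j(T, φ)` of vertices `t` of `T` with `|φ(t)| = j`. -/
noncomputable def numVertex (P : FTree F T) (j : ℕ) : ℕ :=
  {t : τ | (P.onVertex t).card = j}.ncard

/-- The number `e_j(T, φ)` of edges `e` of `T` with `|φ(e)| = j`. -/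
noncomputable def numEdge (P : FTree F T) (j : ℕ) : ℕ :=
  {e : T.edgeSet | (P.onEdge e).card = j}.ncard

/-- The vertices of the disjoint union of the graphs `J_t = F[φ(t)]`, `t ∈ V(T)`. -/
abbrev PreVertex (P : FTree F T) : Type _ := Σ t : τ, {w : U // w ∈ P.onVertex t}

/-- The basic identifications: the copy of `w` in `J_s` and the copy of `w` in `J_t`, for an edge
`st` of `T` and `w ∈ φ(st)`. -/
def Glue (P : FTree F T) (a b : P.PreVertex) : Prop :=
  ∃ h : T.Adj a.1 b.1,
    a.2.1 = b.2.1 ∧ a.2.1 ∈ P.onEdge ⟨s(a.1, b.1), T.mem_edgeSet.2 h⟩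

/-- The vertex set of `H(T, φ)`: the quotient by the equivalence relation generated by `Glue`. -/
def Vertex (P : FTree F T) : Type _ := Quot P.Glue

noncomputable instance [Finite τ] (P : FTree F T) : Fintype P.Vertex :=
  haveI : Finite P.Vertex := inferInstanceAs (Finite (Quot P.Glue))
  Fintype.ofFinite _

/-- The image in `H(T, φ)` of the copy of `w` in `J_t`. -/
def copy (P : FTree F T) (t : τ) (w : U) (hw : w ∈ P.onVertex t) : P.Vertex :=
  Quot.mk _ ⟨t, w, hw⟩

/-- The vertex of `F` of which a given vertex of `H(T, φ)` is a copy. -/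
def label (P : FTree F T) : P.Vertex → U :=
  Quot.lift (fun a => a.2.1) (fun _ _ h => h.2.1)

/-- The graph `H(T, φ)`: the disjoint union of the graphs `F[φ(t)]`, `t ∈ V(T)`, after the
identifications. Two vertices are adjacent if they are the images of two adjacent vertices of
some `F[φ(t)]`. -/
def graph (P : FTree F T) : SimpleGraph P.Vertex where
  Adj a b := ∃ (t : τ) (w w' : U) (hw : w ∈ P.onVertex t) (hw' : w' ∈ P.onVertex t),
    F.Adj w w' ∧ P.copy t w hw = a ∧ P.copy t w' hw' = b
  symm := by
    constructor
    rintro a b ⟨t, w, w', hw, hw', h, ha, hb⟩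
    exact ⟨t, w', w, hw', hw, h.symm, hb, ha⟩
  loopless := by
    constructor
    rintro a ⟨t, w, w', hw, hw', h, ha, hb⟩
    exact h.ne (congrArg P.label (ha.trans hb.symm))

end FTree

/-!
Write `p` and `t` for the densities of an edge and of a triangle in a graphon `W`, and `v₃`, `v₂`,
`e₂` for the numbers attached to `(T, φ)`. The proof combines a lower bound on the density of
`H = H(T, φ)` in terms of `p` and `t` with the constraints that `p` and `t` satisfy.

*The density of `H`.* The inequality is `t ^ v₃ ≤ t(H, W) * p ^ (e₂ - v₂)`
(`Graphon.triangleDensity_pow_le`). The graph `H` can be built by adding vertices that are isolated,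
pendant, or adjacent to both ends of an edge (`BuiltGraph`); there are `v₃` steps of the last kind
and `v₃ + v₂ - e₂` isolated or pendant edges (`FTree.exists_builtGraph`). A random copy of `H` is
drawn along such a construction so that every edge is distributed like an edge of a random triangle
of `W`, with each new vertex conditionally independent of the older ones given its neighbours. The
chain rule for the entropy evaluates the mean of the logarithm of (edge weights / density) up to
Jensen's inequality: with `C` the mean logarithm of the codegree of an edge of a random triangle, a
vertex that closes a triangle contributes `C`, and an isolated or pendant edge at least `log t - C`
(`Graphon.exists_entropyData`). Finally `log t(H, W)` is at least this mean
(`Graphon.exp_integral_le`), and `log t - log p ≤ C`. Logarithms need a positive lower bound on `W`,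
which is removed by mixing `W` with the constant `1`.

*The constraints.* Let `t'` be the triangle density of `1 - W`. Goodman's identity gives
`1 - 3 p + 3 p ^ 2 ≤ t + t'` (`Graphon.goodman`). Bollobás's bound is `4 p - 2 ≤ 3 t`
(`Graphon.bollobas`). It follows by sampling from an inequality for graphs with weighted vertices
(`graphSchur_nonneg`): Zykov symmetrization reduces it to cliques, where it is an extension of
Schur's inequality to any number of variables (`schur_finset`).

*The optimization.* Since densities are multiplicative over disjoint unions and `F` is Sidorenko,
`t ^ k * p ^ m ≤ t(H ⊔ F, W)` with `k = v₃` and `m = e(F) - (e₂ - v₂)`, and likewise for `1 - W`. By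
symmetry `p ≥ 1 / 2`. With `u = 2 p - 1`, `A = 8 t` and `B = 8 t'`, commonness follows from
`2 ≤ A ^ k * (1 + u) ^ m + B ^ k * (1 - u) ^ m`, under the constraints `2 + 6 u ^ 2 ≤ A + B` and
`16 u / 3 ≤ A`, for `-k ≤ m ≤ 5 k / 3` if `k ≥ 3` (`two_le_pow_sum_of_three_le`) and for
`-2 ≤ m ≤ 2` if `k = 2` (`two_le_sq_sum`). Bernoulli's inequality reduces the former to `k = 3`
with a real exponent. If `u` is small, the first constraint and Hölder's inequality suffice; if `u` is large,
the term of `A` alone is at least `2`; the second constraint is needed in between.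
-/

/-! ### The optimization problem in the two triangle densities -/

/-- Radon's inequality `(A + B) ^ 3 / (P + R) ^ 2 ≤ A ^ 3 / P ^ 2 + B ^ 3 / R ^ 2`, with a lower
bound for its left side. -/
theorem radon_cube {A B P R S : ℝ} (hA : 0 ≤ A) (hB : 0 ≤ B) (hP : 0 < P) (hR : 0 < R)
    (hS : 0 ≤ S) (hAB : S ≤ A + B) (h : 2 * (P + R) ^ 2 ≤ S ^ 3) :
    2 ≤ A ^ 3 / P ^ 2 + B ^ 3 / R ^ 2 := by
  set σ := S / (P + R) with hσ
  have hσ0 : 0 ≤ σ := by positivity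
  -- The left side is the tangent at `a = σ r`; equality in Radon's inequality is at such points.
  have key : ∀ {a r : ℝ}, 0 ≤ a → 0 < r → 3 * σ ^ 2 * a - 2 * σ ^ 3 * r ≤ a ^ 3 / r ^ 2 := by
    intro a r ha hr
    rw [le_div_iff₀ (by positivity)]
    have : 0 ≤ (a - σ * r) ^ 2 * (a + 2 * (σ * r)) := by positivity
    nlinarith [this]
  have h1 := key hA hP
  have h2 := key hB hR
  have hσS : σ * (P + R) = S := by rw [hσ]; field_simp
  have h3 : 2 ≤ σ ^ 2 * S := by
    rw [hσ, div_pow, div_mul_eq_mul_div, le_div_iff₀ (by positivity)]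
    linarith
  have h4 : σ ^ 2 * S ≤ σ ^ 2 * (A + B) := by gcongr
  have h5 : σ ^ 3 * (P + R) = σ ^ 2 * S := by rw [← hσS]; ring
  nlinarith

/-- The inequality of Cauchy and Schwarz `(A + B) ^ 2 / (P + R) ≤ A ^ 2 / P + B ^ 2 / R`, with a
lower bound for its left side. -/
theorem radon_square {A B P R S : ℝ} (hP : 0 < P) (hR : 0 < R)
    (hS : 0 ≤ S) (hAB : S ≤ A + B) (h : 2 * (P + R) ≤ S ^ 2) :
    2 ≤ A ^ 2 / P + B ^ 2 / R := by
  set σ := S / (P + R) with hσ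
  have hσ0 : 0 ≤ σ := by positivity
  have key : ∀ {a r : ℝ}, 0 < r → 2 * σ * a - σ ^ 2 * r ≤ a ^ 2 / r := by
    intro a r hr
    rw [le_div_iff₀ (by positivity)]
    nlinarith [sq_nonneg (a - σ * r)]
  have h1 := key (a := A) hP
  have h2 := key (a := B) hR
  have hσS : σ * (P + R) = S := by rw [hσ]; field_simp
  have h3 : 2 ≤ σ * S := by
    rw [hσ, div_mul_eq_mul_div, le_div_iff₀ (by positivity)]
    linarith
  have h4 : σ * S ≤ σ * (A + B) := by gcongr
  have h5 : σ ^ 2 * (P + R) = σ * S := by rw [← hσS]; ring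
  nlinarith

/-- The function `r ↦ c ^ r` lies below its chord over `[-s, s]`. -/
theorem rpow_le_convex {c r s : ℝ} (hc : 0 < c) (hs : 0 < s) (h1 : -s ≤ r) (h2 : r ≤ s) :
    c ^ r ≤ (s - r) / (2 * s) * c ^ (-s) + (s + r) / (2 * s) * c ^ s := by
  have hw : (s - r) / (2 * s) + (s + r) / (2 * s) = 1 := by field_simp; ring
  have := Real.geom_mean_le_arith_mean2_weighted (w₁ := (s - r) / (2 * s))
    (w₂ := (s + r) / (2 * s)) (p₁ := c ^ (-s)) (p₂ := c ^ s)
    (div_nonneg (by linarith) (by linarith)) (div_nonneg (by linarith) (by linarith))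
    (by positivity) (by positivity) hw
  refine le_trans (le_of_eq ?_) this
  rw [← Real.rpow_mul hc.le, ← Real.rpow_mul hc.le, ← Real.rpow_add hc]
  congr 1
  field_simp
  ring

/-- With `c = 1 + u` and `d = 1 - u`, the sum `c ^ (-r) + d ^ (-r)` is convex in `r` and larger at
`s` than at `-s`, because `c d ≤ 1`. Hence it is maximal at `r = s` on `[-s, s]`. -/
theorem rpow_neg_add_rpow_neg_le {u r s : ℝ} (hu0 : 0 ≤ u) (hu1 : u < 1) (hs : 0 < s)
    (h1 : -s ≤ r) (h2 : r ≤ s) :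
    (1 + u) ^ (-r) + (1 - u) ^ (-r) ≤ (1 + u) ^ (-s) + (1 - u) ^ (-s) := by
  have hc : 0 < 1 + u := by linarith
  have hd : 0 < 1 - u := by linarith
  have e1 := rpow_le_convex hc hs (r := -r) (by linarith) (by linarith)
  have e2 := rpow_le_convex hd hs (r := -r) (by linarith) (by linarith)
  have hx : 0 < (1 + u) ^ s := by positivity
  have hy : 0 < (1 - u) ^ s := by positivity
  have hxy : (1 + u) ^ s * (1 - u) ^ s ≤ 1 := by
    rw [← Real.mul_rpow hc.le hd.le]
    exact Real.rpow_le_one (by positivity) (by nlinarith) hs.le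
  have h3 : (1 + u) ^ s + (1 - u) ^ s ≤ (1 + u) ^ (-s) + (1 - u) ^ (-s) := by
    rw [Real.rpow_neg hc.le, Real.rpow_neg hd.le]
    have : ((1 + u) ^ s)⁻¹ + ((1 - u) ^ s)⁻¹
        = ((1 + u) ^ s + (1 - u) ^ s) / ((1 + u) ^ s * (1 - u) ^ s) := by
      field_simp; ring
    rw [this, le_div_iff₀ (by positivity)]
    nlinarith
  have hw : (s - -r) / (2 * s) = 1 - (s + -r) / (2 * s) := by field_simp; ring
  have hw0 : 0 ≤ (s + -r) / (2 * s) := div_nonneg (by linarith) (by linarith)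
  rw [hw] at e1 e2
  nlinarith

/-- The exponents for which the bound on `A + B` suffices: by Radon's inequality, all those of
absolute value at most `2 s`, if the case `2 s` is in order. -/
theorem two_le_of_exponent_le {A B u n s : ℝ} (hA : 0 ≤ A) (hB : 0 ≤ B) (hu0 : 0 ≤ u) (hu1 : u < 1)
    (hAB : 2 + 6 * u ^ 2 ≤ A + B) (hs : 0 < s) (h1 : -s ≤ n / 2) (h2 : n / 2 ≤ s)
    (h : 2 * ((1 + u) ^ (-s) + (1 - u) ^ (-s)) ^ 2 ≤ (2 + 6 * u ^ 2) ^ 3) :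
    2 ≤ A ^ 3 * (1 + u) ^ n + B ^ 3 * (1 - u) ^ n := by
  have hc : 0 < 1 + u := by linarith
  have hd : 0 < 1 - u := by linarith
  have key : ∀ {a c : ℝ}, 0 < c → a ^ 3 * c ^ n = a ^ 3 / (c ^ (-(n / 2))) ^ 2 := by
    intro a c hc
    rw [← Real.rpow_natCast (c ^ _), ← Real.rpow_mul hc.le, div_eq_mul_inv, ← Real.rpow_neg hc.le]
    congr 2
    push_cast
    ring
  rw [key hc, key hd]
  refine radon_cube hA hB (by positivity) (by positivity) (by positivity) hAB (le_trans ?_ h)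
  gcongr 2 * ?_ ^ 2
  exact rpow_neg_add_rpow_neg_le hu0 hu1 hs h1 h2

theorem rpow_neg_two_add {u : ℝ} (hu0 : 0 ≤ u) (hu1 : u < 1) :
    (1 + u) ^ (-2 : ℝ) + (1 - u) ^ (-2 : ℝ) = 2 * (1 + u ^ 2) / (1 - u ^ 2) ^ 2 := by
  have hc : 0 < 1 + u := by linarith
  have hd : 0 < 1 - u := by linarith
  rw [Real.rpow_neg hc.le, Real.rpow_neg hd.le]
  norm_cast
  have : 1 - u ^ 2 ≠ 0 := by nlinarith
  rw [show (1 - u ^ 2) = (1 + u) * (1 - u) by ring]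
  field_simp
  ring

/-- The condition of `two_le_of_exponent_le` for exponents up to `4`. -/
theorem holder_four {u : ℝ} (hu0 : 0 ≤ u) (hu1 : u ≤ 1 / 2) :
    2 * ((1 + u) ^ (-2 : ℝ) + (1 - u) ^ (-2 : ℝ)) ^ 2 ≤ (2 + 6 * u ^ 2) ^ 3 := by
  rw [rpow_neg_two_add hu0 (by linarith)]
  have ht1 : u ^ 2 ≤ 1 / 4 := by nlinarith
  have ht0 : 0 ≤ u ^ 2 := by positivity
  generalize u ^ 2 = t at *
  rw [div_pow, mul_div_assoc', div_le_iff₀ (by have : 0 < 1 - t := by linarith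
                                               positivity)]
  have : 0 ≤ t * (1 / 4 - t) := mul_nonneg ht0 (by linarith)
  have h3 : 1 + 5 * t / 4 ≤ (1 + 3 * t) * (1 - t) := by nlinarith
  have h4 : (1 + t) ^ 2 ≤ (1 + 5 * t / 4) ^ 3 * (1 - t) := by
    nlinarith [mul_nonneg ht0 this, mul_nonneg (mul_nonneg ht0 ht0) this]
  have h5 : (1 + 5 * t / 4) ^ 3 * (1 - t) ≤ ((1 + 3 * t) * (1 - t)) ^ 3 * (1 - t) := by
    gcongr; linarith
  nlinarith

/-- The condition of `two_le_of_exponent_le` for exponents up to `5`, which holds for small `u`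
only. -/
theorem holder_five {u : ℝ} (hu0 : 0 ≤ u) (hu1 : u ≤ 7 / 50) :
    2 * ((1 + u) ^ (-(5 / 2) : ℝ) + (1 - u) ^ (-(5 / 2) : ℝ)) ^ 2 ≤ (2 + 6 * u ^ 2) ^ 3 := by
  have hc : 0 < 1 + u := by linarith
  have hd : 0 < 1 - u := by linarith
  have ht1 : u ^ 2 ≤ 1 / 50 := by nlinarith
  have ht0 : 0 ≤ u ^ 2 := by positivity
  have hsq : ∀ {c : ℝ}, 0 < c → (c ^ (-(5 / 2) : ℝ)) ^ 2 = 1 / c ^ 5 := by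
    intro c hc
    rw [← Real.rpow_natCast, ← Real.rpow_mul hc.le, one_div, ← Real.rpow_natCast c 5,
      ← Real.rpow_neg hc.le]
    norm_num
  have hm : (1 + u) ^ (-(5 / 2) : ℝ) * (1 - u) ^ (-(5 / 2) : ℝ)
      = √(1 - u ^ 2) / (1 - u ^ 2) ^ 3 := by
    have h0 : 0 < 1 - u ^ 2 := by nlinarith
    rw [← Real.mul_rpow hc.le hd.le, show (1 + u) * (1 - u) = 1 - u ^ 2 by ring, Real.sqrt_eq_rpow,
      ← Real.rpow_natCast _ 3, ← Real.rpow_sub h0]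
    norm_num
  have hs : √(1 - u ^ 2) ≤ 1 - u ^ 2 / 2 := Real.sqrt_le_iff.2 ⟨by linarith, by nlinarith⟩
  have h1 : 1 / (1 + u) ^ 5 + 1 / (1 - u) ^ 5
      = 2 * (1 + 10 * u ^ 2 + 5 * (u ^ 2) ^ 2) / (1 - u ^ 2) ^ 5 := by
    rw [show (1 - u ^ 2) = (1 + u) * (1 - u) by ring]
    field_simp
    ring
  rw [add_sq, hsq hc, hsq hd, mul_assoc 2 (_ ^ _), hm]
  rw [show ∀ a b c : ℝ, 2 * (1 / a + 2 * c + 1 / b) = 2 * (1 / a + 1 / b) + 4 * c by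
    intros; ring, h1]
  generalize √(1 - u ^ 2) = s at *
  generalize u ^ 2 = t at *
  have h0 : 0 < 1 - t := by linarith
  have h2 : s / (1 - t) ^ 3 ≤ (1 - t / 2) * (1 - t) ^ 2 / (1 - t) ^ 5 := by
    rw [div_le_div_iff₀ (by positivity) (by positivity)]
    have : s * (1 - t) ^ 5 ≤ (1 - t / 2) * (1 - t) ^ 5 := by gcongr
    linarith
  have h3 : 4 * (1 + 10 * t + 5 * t ^ 2) + 4 * ((1 - t / 2) * (1 - t) ^ 2)
      ≤ (2 + 6 * t) ^ 3 * (1 - t) ^ 5 := by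
    have e1 : 0 ≤ t * (1 / 50 - t) := mul_nonneg ht0 (by linarith)
    have e2 := mul_nonneg ht0 e1
    have e3 := mul_nonneg ht0 e2
    have e4 := mul_nonneg ht0 e3
    have e5 := mul_nonneg ht0 e4
    have e6 := mul_nonneg ht0 e5
    have e7 := mul_nonneg ht0 e6
    have e8 : 0 ≤ t ^ 5 := by positivity
    nlinarith
  have h4 : 2 * (2 * (1 + 10 * t + 5 * t ^ 2) / (1 - t) ^ 5)
      + 4 * ((1 - t / 2) * (1 - t) ^ 2 / (1 - t) ^ 5) ≤ (2 + 6 * t) ^ 3 := by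
    rw [mul_div_assoc', mul_div_assoc', ← add_div, div_le_iff₀ (by positivity)]
    linarith
  linarith

/-- The optimization problem with exponent `5`, where both constraints are tight. -/
theorem two_le_quintic_at_linear_bound {u : ℝ} (h1 : 7 / 50 ≤ u) (h2 : u ≤ 19 / 100) :
    2 ≤ (16 * u / 3) ^ 3 * (1 + u) ^ 5 + (2 + 6 * u ^ 2 - 16 * u / 3) ^ 3 * (1 - u) ^ 5 := by
  obtain ⟨v, rfl⟩ : ∃ v, u = 7 / 50 + v / 20 := ⟨20 * (u - 7 / 50), by ring⟩
  have hv0 : 0 ≤ v := by linarith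
  have hv1 : v ≤ 1 := by linarith
  -- As a polynomial in `v`, the difference has negative coefficients at `v ^ 5`, `v ^ 7`, `v ^ 9`,
  -- `v ^ 11` only, and these are absorbed by the one at `v ^ 2`.
  have p1 : ∀ n : ℕ, 0 ≤ v ^ n := fun n => pow_nonneg hv0 n
  have p2 : ∀ {m n : ℕ}, m ≤ n → v ^ n ≤ v ^ m := fun h => pow_le_pow_of_le_one hv0 hv1 h
  have := p2 (show 2 ≤ 5 by norm_num)
  have := p2 (show 2 ≤ 7 by norm_num)
  have := p2 (show 2 ≤ 9 by norm_num)
  have := p2 (show 2 ≤ 11 by norm_num)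
  linarith [p1 2, p1 3, p1 4, p1 6, p1 8, p1 10]

/-- The optimization problem with exponent `5` for `u ≤ 19 / 100`. Up to `7 / 50` the bound on
`A + B` suffices; then the minimum is where both constraints are tight. -/
theorem two_le_quintic {A B u : ℝ} (hA : 0 ≤ A) (hB : 0 ≤ B) (hu0 : 0 ≤ u) (hu1 : u ≤ 19 / 100)
    (hAB : 2 + 6 * u ^ 2 ≤ A + B) (hAL : 16 * u / 3 ≤ A) :
    2 ≤ A ^ 3 * (1 + u) ^ 5 + B ^ 3 * (1 - u) ^ 5 := by
  rcases le_total u (7 / 50) with h | h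
  · have := two_le_of_exponent_le hA hB (n := 5) (s := 5 / 2) hu0 (by linarith) hAB (by norm_num)
      (by norm_num) (by norm_num) (holder_five hu0 h)
    exact_mod_cast this
  · -- The tangent of the cube at `l`.
    have key : ∀ {a l : ℝ}, 0 ≤ a → 0 ≤ l → l ^ 3 + 3 * l ^ 2 * (a - l) ≤ a ^ 3 := by
      intro a l ha hl
      have : 0 ≤ (a - l) ^ 2 * (a + 2 * l) := by positivity
      nlinarith
    have hc : 0 ≤ (1 + u) ^ 5 := by positivity
    have hd : 0 ≤ (1 - u) ^ 5 := pow_nonneg (by linarith) _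
    have hβ0 : 0 ≤ 2 + 6 * u ^ 2 - 16 * u / 3 := by nlinarith
    have k1 := mul_le_mul_of_nonneg_right (key hA (show 0 ≤ 16 * u / 3 by positivity)) hc
    have k2 := mul_le_mul_of_nonneg_right (key hB hβ0) hd
    have k3 := two_le_quintic_at_linear_bound h hu1
    set L := 16 * u / 3 with hL
    set β := 2 + 6 * u ^ 2 - L with hβ
    -- The tangent line of the first cube at `L` is steeper than that of the second one at `β`.
    have k4 : β ^ 2 * (1 - u) ^ 5 ≤ L ^ 2 * (1 + u) ^ 5 := by
      have a1 : β ≤ 69 / 50 := by rw [hβ, hL]; nlinarith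
      have a2 : 56 / 75 ≤ L := by rw [hL]; linarith
      calc β ^ 2 * (1 - u) ^ 5 ≤ (69 / 50) ^ 2 * (1 - 7 / 50) ^ 5 := by
            gcongr
            linarith
        _ ≤ (56 / 75) ^ 2 * (1 + 7 / 50) ^ 5 := by norm_num
        _ ≤ _ := by gcongr
    have k5 : 0 ≤ (A - L) * (L ^ 2 * (1 + u) ^ 5 - β ^ 2 * (1 - u) ^ 5) :=
      mul_nonneg (by linarith) (by linarith)
    have k6 : 0 ≤ (B - β + (A - L)) * (β ^ 2 * (1 - u) ^ 5) :=
      mul_nonneg (by rw [hβ]; linarith) (by positivity)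
    linarith

/-- The optimization problem with exponent `4`, sharpened by the factor `1 - u ^ 2` that the
interpolation in `two_le_of_exponent_mem_Icc` costs at this end. -/
theorem two_le_quartic {A B u : ℝ} (hA : 0 ≤ A) (hB : 0 ≤ B) (hu0 : 0 ≤ u) (hu1 : u ≤ 19 / 100)
    (hAB : 2 + 6 * u ^ 2 ≤ A + B) :
    2 ≤ (1 - u ^ 2) * (A ^ 3 * (1 + u) ^ 4 + B ^ 3 * (1 - u) ^ 4) := by
  have hc : 0 < 1 + u := by linarith
  have hd : 0 < 1 - u := by linarith
  have h0 : 0 < 1 - u ^ 2 := by nlinarith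
  -- The ratio of `2 + 6 u ^ 2` to `(1 + u) ^ (-2) + (1 - u) ^ (-2)`, as in `radon_cube`.
  set σ := (1 - u ^ 2) ^ 2 * (1 + 3 * u ^ 2) / (1 + u ^ 2) with hσ
  have hσ0 : 0 ≤ σ := by positivity
  have key : ∀ {a r : ℝ}, 0 ≤ a → 0 < r → 3 * σ ^ 2 * a - 2 * σ ^ 3 / r ^ 2 ≤ a ^ 3 * r ^ 4 := by
    intro a r ha hr
    rw [div_eq_mul_inv, ← inv_pow]
    have h1 : 0 ≤ (a - σ * r⁻¹ ^ 2) ^ 2 * (a + 2 * (σ * r⁻¹ ^ 2)) := by positivity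
    have h2 : r⁻¹ * r = 1 := inv_mul_cancel₀ hr.ne'
    have h3 : 0 ≤ r ^ 4 * ((a - σ * r⁻¹ ^ 2) ^ 2 * (a + 2 * (σ * r⁻¹ ^ 2))) := by positivity
    have h4 : r ^ 4 * ((a - σ * r⁻¹ ^ 2) ^ 2 * (a + 2 * (σ * r⁻¹ ^ 2)))
      = a ^ 3 * r ^ 4 - 3 * σ ^ 2 * a * (r⁻¹ * r) ^ 4
        + 2 * σ ^ 3 * r⁻¹ ^ 2 * (r⁻¹ * r) ^ 4 := by ring
    rw [h4, h2] at h3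
    linarith
  have k1 := key hA hc
  have k2 := key hB hd
  have k3 : 2 * σ ^ 3 / (1 + u) ^ 2 + 2 * σ ^ 3 / (1 - u) ^ 2 = 2 * σ ^ 2 * (2 + 6 * u ^ 2) := by
    have : 2 * σ ^ 3 / (1 + u) ^ 2 + 2 * σ ^ 3 / (1 - u) ^ 2
      = 2 * σ ^ 2 * σ * (2 * (1 + u ^ 2) / (1 - u ^ 2) ^ 2) := by
      rw [show (1 - u ^ 2) = (1 + u) * (1 - u) by ring]
      field_simp
      ring
    rw [this, hσ]
    field_simp
    ring
  have k4 : 3 * σ ^ 2 * (2 + 6 * u ^ 2) ≤ 3 * σ ^ 2 * (A + B) := by gcongr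
  have k5 : σ ^ 2 * (2 + 6 * u ^ 2) ≤ A ^ 3 * (1 + u) ^ 4 + B ^ 3 * (1 - u) ^ 4 := by linarith
  refine le_trans ?_ (mul_le_mul_of_nonneg_left k5 h0.le)
  have ht1 : u ^ 2 ≤ 1 / 20 := by nlinarith
  have ht0 : 0 ≤ u ^ 2 := by positivity
  rw [hσ]
  generalize u ^ 2 = t at *
  rw [div_pow, div_mul_eq_mul_div, mul_div_assoc', le_div_iff₀ (by positivity)]
  have e1 : 0 ≤ t * (1 / 20 - t) := mul_nonneg ht0 (by linarith)
  have e2 : 1 + 17 * t / 10 ≤ (1 + 3 * t) * (1 - t) := by nlinarith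
  have e3 : (1 + 17 * t / 10) ^ 3 * (1 - t) ^ 2 ≤ ((1 + 3 * t) * (1 - t)) ^ 3 * (1 - t) ^ 2 := by
    gcongr
  have e4 : (1 + t) ^ 2 ≤ (1 + 17 * t / 10) ^ 3 * (1 - t) ^ 2 := by
    nlinarith [mul_nonneg ht0 e1, mul_nonneg (mul_nonneg ht0 ht0) e1,
      mul_nonneg (mul_nonneg ht0 (mul_nonneg ht0 ht0)) e1]
  nlinarith

/-- On `[4, 5]` the powers `(1 ± u) ^ n` are bounded below by affine functions of `n` that agree
with them at `n = 5`, which leaves the two ends of the interval. -/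
theorem two_le_of_exponent_mem_Icc {A B u n : ℝ} (hA : 0 ≤ A) (hB : 0 ≤ B) (hu0 : 0 ≤ u)
    (hu1 : u < 1) (hAB : 2 + 6 * u ^ 2 ≤ A + B) (hAL : 16 * u / 3 ≤ A) (h4 : 4 ≤ n) (h5 : n ≤ 5) :
    2 ≤ A ^ 3 * (1 + u) ^ n + B ^ 3 * (1 - u) ^ n := by
  have hc : 0 < 1 + u := by linarith
  have hd : 0 < 1 - u := by linarith
  rcases le_total (19 / 100) u with h | h
  · -- Here the term of `A` alone is large enough.
    have k1 : (76 / 75 : ℝ) ^ 3 * (1 + 19 / 100) ^ 4 ≤ A ^ 3 * (1 + u) ^ 4 := by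
      gcongr
      linarith
    have k2 : A ^ 3 * (1 + u) ^ 4 ≤ A ^ 3 * (1 + u) ^ n := by
      rw [← Real.rpow_natCast (1 + u)]
      gcongr
      · linarith
      · exact_mod_cast h4
    have k3 : 0 ≤ B ^ 3 * (1 - u) ^ n := by positivity
    norm_num at k1
    linarith
  · have p : ∀ {x : ℝ}, 0 < x → x ^ 5 * (1 - (5 - n) * (x - 1)) ≤ x ^ n := by
      intro x hx
      have e : x ^ n = x ^ 5 * x ^ (-(5 - n)) := by
        rw [← Real.rpow_natCast, ← Real.rpow_add hx]
        congr 1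
        push_cast
        ring
      rw [e]
      gcongr
      rw [Real.rpow_def_of_pos hx]
      have := Real.add_one_le_exp (Real.log x * -(5 - n))
      have := Real.log_le_sub_one_of_pos hx
      nlinarith
    have k1 := mul_le_mul_of_nonneg_left (p hc) (pow_nonneg hA 3)
    have k2 := mul_le_mul_of_nonneg_left (p hd) (pow_nonneg hB 3)
    have k3 := two_le_quintic hA hB hu0 h hAB hAL
    have k4 := two_le_quartic hA hB hu0 h hAB
    have k5 := mul_le_mul_of_nonneg_left k3 (show 0 ≤ 1 - (5 - n) by linarith)
    have k6 := mul_le_mul_of_nonneg_left k4 (show 0 ≤ 5 - n by linarith)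
    nlinarith

/-- The optimization problem for `k = 3` and a real exponent. -/
theorem two_le_cube_sum {A B u n : ℝ} (hA : 0 ≤ A) (hB : 0 ≤ B) (hu0 : 0 ≤ u)
    (hu1 : u < 1) (hAB : 2 + 6 * u ^ 2 ≤ A + B) (hAL : 16 * u / 3 ≤ A) (h3 : -3 ≤ n) (h5 : n ≤ 5) :
    2 ≤ A ^ 3 * (1 + u) ^ n + B ^ 3 * (1 - u) ^ n := by
  rcases le_total 4 n with h4 | h4
  · exact two_le_of_exponent_mem_Icc hA hB hu0 hu1 hAB hAL h4 h5
  rcases le_total u (1 / 2) with h | h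
  · exact two_le_of_exponent_le hA hB hu0 hu1 hAB two_pos (by linarith) (by linarith)
      (holder_four hu0 h)
  · -- Here `A / (1 + u)` is at least `16 / 9`, so the term of `A` alone is large enough.
    have hc : 0 < 1 + u := by linarith
    have hd : 0 < 1 - u := by linarith
    have k1 : (1 + u) ^ (-3 : ℝ) ≤ (1 + u) ^ n := by
      gcongr
      linarith
    have k2 : (1 + u) ^ (-3 : ℝ) = ((1 + u) ^ 3)⁻¹ := by
      rw [Real.rpow_neg hc.le]
      norm_cast
    have k3 : (16 / 9 : ℝ) ≤ A / (1 + u) := by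
      rw [le_div_iff₀ hc]
      linarith
    have k4 : (16 / 9 : ℝ) ^ 3 ≤ (A / (1 + u)) ^ 3 := by gcongr
    have k5 : (A / (1 + u)) ^ 3 ≤ A ^ 3 * (1 + u) ^ n := by
      rw [div_pow, div_eq_mul_inv, ← k2]
      gcongr
    have k6 : 0 ≤ B ^ 3 * (1 - u) ^ n := by positivity
    norm_num at k4
    linarith

/-- The optimization problem behind the case of at least three triangles. Bernoulli's inequality
for the exponent `k / 3` reduces it to that of `two_le_cube_sum`. -/
theorem two_le_pow_sum_of_three_le {A B u : ℝ} {k : ℕ} {m : ℤ} (hA : 0 ≤ A) (hB : 0 ≤ B)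
    (hu0 : 0 ≤ u) (hu1 : u < 1) (hAB : 2 + 6 * u ^ 2 ≤ A + B) (hAL : 16 * u / 3 ≤ A) (hk : 3 ≤ k)
    (hm1 : -(k : ℝ) ≤ m) (hm2 : (m : ℝ) ≤ 5 * k / 3) :
    2 ≤ A ^ k * (1 + u) ^ m + B ^ k * (1 - u) ^ m := by
  have hk0 : (3 : ℝ) ≤ k := by exact_mod_cast hk
  have h := two_le_cube_sum (n := 3 * m / k) hA hB hu0 hu1 hAB hAL
    (by rw [le_div_iff₀ (by linarith)]; linarith) (by rw [div_le_iff₀ (by linarith)]; linarith)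
  have p : ∀ {a x : ℝ}, 0 ≤ a → 0 < x →
      1 + k / 3 * (a ^ 3 * x ^ (3 * m / k : ℝ) - 1) ≤ a ^ k * x ^ m := by
    intro a x ha hx
    have := one_add_mul_self_le_rpow_one_add (s := a ^ 3 * x ^ (3 * m / k : ℝ) - 1) (p := k / 3)
      (by linarith [show 0 ≤ a ^ 3 * x ^ (3 * m / k : ℝ) by positivity]) (by linarith)
    refine this.trans (le_of_eq ?_)
    rw [add_sub_cancel, Real.mul_rpow (by positivity) (by positivity), ← Real.rpow_natCast a 3,
      ← Real.rpow_mul ha, ← Real.rpow_mul hx.le, ← Real.rpow_natCast a k, ← Real.rpow_intCast x m]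
    congr 2
    · push_cast; ring
    · field_simp
  have h1 := p hA (show 0 < 1 + u by linarith)
  have h2 := p hB (show 0 < 1 - u by linarith)
  nlinarith

/-- The optimization problem behind the case of two triangles. -/
theorem two_le_sq_sum {A B u : ℝ} {m : ℤ}
    (hu0 : 0 ≤ u) (hu1 : u < 1) (hAB : 2 + 6 * u ^ 2 ≤ A + B) (hAL : 16 * u / 3 ≤ A)
    (hm1 : -2 ≤ m) (hm2 : m ≤ 2) :
    2 ≤ A ^ 2 * (1 + u) ^ m + B ^ 2 * (1 - u) ^ m := by
  have hc : 0 < 1 + u := by linarith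
  have hd : 0 < 1 - u := by linarith
  rcases le_total u (1 / 2) with h | h
  · have key : ∀ {a c : ℝ}, 0 < c → a ^ 2 * c ^ m = a ^ 2 / (c ^ (-m : ℝ)) := by
      intro a c hc
      rw [Real.rpow_neg hc.le, div_inv_eq_mul, Real.rpow_intCast]
    rw [key hc, key hd]
    refine radon_square (by positivity) (by positivity) (by positivity) hAB ?_
    have := rpow_neg_add_rpow_neg_le (r := m) (s := 2) hu0 hu1 two_pos (by exact_mod_cast hm1)
      (by exact_mod_cast hm2)
    rw [rpow_neg_two_add hu0 hu1] at this
    refine (mul_le_mul_of_nonneg_left this two_pos.le).trans ?_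
    have ht1 : u ^ 2 ≤ 1 / 4 := by nlinarith
    have ht0 : 0 ≤ u ^ 2 := by positivity
    generalize u ^ 2 = t at *
    rw [mul_div_assoc', div_le_iff₀ (by have : 0 < 1 - t := by linarith
                                        positivity)]
    have e1 : 0 ≤ t * (1 / 4 - t) := mul_nonneg ht0 (by linarith)
    have e2 : 1 + 5 * t / 4 ≤ (1 + 3 * t) * (1 - t) := by nlinarith
    have e3 : (1 + 5 * t / 4) ^ 2 ≤ ((1 + 3 * t) * (1 - t)) ^ 2 := by gcongr
    nlinarith
  · -- Here `A / (1 + u)` is at least `16 / 9`, so the term of `A` alone is large enough.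
    have k1 : (1 + u) ^ (-2 : ℤ) ≤ (1 + u) ^ m := zpow_le_zpow_right₀ (by linarith) hm1
    have k2 : (1 + u) ^ (-2 : ℤ) = ((1 + u) ^ 2)⁻¹ := by
      rw [zpow_neg]
      norm_cast
    have k3 : (16 / 9 : ℝ) ≤ A / (1 + u) := by
      rw [le_div_iff₀ hc]
      linarith
    have k4 : (16 / 9 : ℝ) ^ 2 ≤ (A / (1 + u)) ^ 2 := by gcongr
    have k5 : (A / (1 + u)) ^ 2 ≤ A ^ 2 * (1 + u) ^ m := by
      rw [div_pow, div_eq_mul_inv, ← k2]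
      gcongr
    have k6 : 0 ≤ B ^ 2 * (1 - u) ^ m := by positivity
    norm_num at k4
    linarith

/-- The optimization problem for `u = 1`, where `1 - u` has no negative powers. -/
theorem two_le_pow_of_eq_one {A : ℝ} {k : ℕ} {m : ℤ} (hA : 16 / 3 ≤ A) (hk : 2 ≤ k)
    (hm1 : -(k : ℤ) ≤ m) : 2 ≤ A ^ k * 2 ^ m := by
  have k1 : (2 : ℝ) ^ (-(k : ℤ)) ≤ 2 ^ m := zpow_le_zpow_right₀ (by norm_num) hm1
  have k2 : 2 ≤ A ^ k * (2 : ℝ) ^ (-(k : ℤ)) := by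
    rw [zpow_neg, zpow_natCast, ← div_eq_mul_inv, ← div_pow]
    calc (2 : ℝ) ≤ 2 ^ 2 := by norm_num
      _ ≤ 2 ^ k := pow_le_pow_right₀ (by norm_num) hk
      _ ≤ _ := by gcongr; linarith
  exact k2.trans (by gcongr)

/-! ### Schur's inequality for weighted graphs -/

/-- The kernel of the cubic form `graphSchur`. -/
noncomputable def graphSchurKernel {ι : Type*} (w : Sym2 ι → ℝ) (a b c : ι) : ℝ :=
  2 - 4 / 3 * (w s(a, b) + w s(b, c) + w s(a, c)) + 3 * (w s(a, b) * w s(b, c) * w s(a, c))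

/-- For a graph with vertex weights `x` of total `s` and edge weights `w`, this is `2 s³` minus
`4 s` times the weighted number of (ordered) edges plus `3` times the weighted number of (ordered)
triangles, written as a cubic form in `x`. For a triangle it is twice the form of Schur's
inequality. -/
noncomputable def graphSchur {ι : Type*} [Fintype ι] (w : Sym2 ι → ℝ) (x : ι → ℝ) : ℝ :=
  ∑ a, ∑ b, ∑ c, x a * x b * x c * graphSchurKernel w a b c

/-- The kernel is affine in the weight of every edge, as that of a loop is zero. -/
theorem graphSchurKernel_update {ι : Type*} [DecidableEq ι] {w : Sym2 ι → ℝ}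
    (hw : ∀ a, w s(a, a) = 0) {e : Sym2 ι} (he : ¬ e.IsDiag) (τ : ℝ) (a b c : ι) :
    graphSchurKernel (Function.update w e τ) a b c
      = (1 - τ) * graphSchurKernel (Function.update w e 0) a b c
        + τ * graphSchurKernel (Function.update w e 1) a b c := by
  have hd : ∀ (t : ℝ) (a : ι), Function.update w e t s(a, a) = 0 := by
    intro t a
    rw [Function.update_of_ne _ _ _, hw]
    rintro rfl
    exact he (Sym2.mk_isDiag_iff.2 rfl)
  have hv : ∀ (t : ℝ) (f : Sym2 ι), Function.update w e t f = if f = e then t else w f :=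
    fun t f => Function.update_apply _ _ _ _
  unfold graphSchurKernel
  by_cases hab : a = b
  · subst hab
    simp only [hd, hv]
    split_ifs <;> ring
  by_cases hbc : b = c
  · subst hbc
    simp only [hd, hv]
    split_ifs <;> ring
  by_cases hac : a = c
  · subst hac
    simp only [hd, hv]
    split_ifs <;> ring
  -- For distinct `a`, `b`, `c`, at most one of the three pairs is `e`; the other cases that
  -- `split_ifs` produces are contradictory.
  simp only [hv]
  split_ifs with h1 h2 h3 h4 h5 h6 h7
  any_goals ring1
  all_goals
    subst e
    simp only [Sym2.eq_iff] at *
    grind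

theorem graphSchur_update {ι : Type*} [Fintype ι] [DecidableEq ι] {w : Sym2 ι → ℝ}
    (hw : ∀ a, w s(a, a) = 0) {e : Sym2 ι} (he : ¬ e.IsDiag) (τ : ℝ) (x : ι → ℝ) :
    graphSchur (Function.update w e τ) x
      = (1 - τ) * graphSchur (Function.update w e 0) x
        + τ * graphSchur (Function.update w e 1) x := by
  unfold graphSchur
  simp only [Finset.mul_sum, ← Finset.sum_add_distrib]
  refine Finset.sum_congr rfl fun a _ => Finset.sum_congr rfl fun b _ =>
    Finset.sum_congr rfl fun c _ => ?_
  rw [graphSchurKernel_update hw he]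
  ring

/-- Moving weight between two non-adjacent vertices changes the form affinely. -/
theorem graphSchur_shift {ι : Type*} [Fintype ι] [DecidableEq ι] {w : Sym2 ι → ℝ}
    (hw : ∀ a, w s(a, a) = 0) {i j : ι} (hij : w s(i, j) = 0) (x : ι → ℝ) :
    ∃ D : ℝ, ∀ s : ℝ, graphSchur w (x + s • (Pi.single i 1 - Pi.single j 1 : ι → ℝ))
      = graphSchur w x + s * D := by
  set δ : ι → ℝ := Pi.single i 1 - Pi.single j 1 with hδ
  have hsum : ∀ f : ι → ℝ, ∑ a, δ a * f a = f i - f j := by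
    intro f
    simp [hδ, sub_mul, Finset.sum_sub_distrib, Pi.single_apply]
  have hji : w s(j, i) = 0 := by rw [Sym2.eq_swap, hij]
  let K := graphSchurKernel w
  have k2 : ∀ c, K i i c - K i j c - (K j i c - K j j c) = 0 := by
    intro c; simp only [K, graphSchurKernel, hw, hij, hji]; ring
  have k2' : ∀ c, K i c i - K i c j - (K j c i - K j c j) = 0 := by
    intro c
    simp only [K, graphSchurKernel, hw, hij, hji, Sym2.eq_swap (a := c)]; ring
  have k2'' : ∀ c, K c i i - K c i j - (K c j i - K c j j) = 0 := by
    intro c; simp only [K, graphSchurKernel, hw, hij, hji]; ring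
  -- The coefficients of `s ^ 2` and `s ^ 3` vanish, since `i` and `j` are not adjacent.
  refine ⟨∑ a, ∑ b, ∑ c, (δ a * x b * x c + x a * δ b * x c + x a * x b * δ c) * K a b c,
    fun s => ?_⟩
  have e0 : ∑ a, ∑ b, ∑ c, (δ a * δ b * x c) * K a b c = 0 := by
    simp only [mul_assoc, ← Finset.mul_sum, hsum]
    rw [← Finset.sum_sub_distrib, ← Finset.sum_sub_distrib, ← Finset.sum_sub_distrib]
    refine Finset.sum_eq_zero fun c _ => ?_
    linear_combination x c * k2 c
  have e1 : ∑ a, ∑ b, ∑ c, (δ a * x b * δ c) * K a b c = 0 := by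
    simp only [mul_assoc, ← Finset.mul_sum, mul_left_comm (x _) (δ _), hsum]
    rw [← Finset.sum_sub_distrib]
    refine Finset.sum_eq_zero fun c _ => ?_
    linear_combination x c * k2' c
  have e2 : ∑ a, ∑ b, ∑ c, (x a * δ b * δ c) * K a b c = 0 := by
    simp only [mul_assoc, ← Finset.mul_sum, hsum]
    refine Finset.sum_eq_zero fun c _ => ?_
    linear_combination x c * k2'' c
  have e3 : ∑ a, ∑ b, ∑ c, (δ a * δ b * δ c) * K a b c = 0 := by
    simp only [mul_assoc, ← Finset.mul_sum, hsum]
    linear_combination k2 i - k2 j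
  calc graphSchur w (x + s • δ)
      = graphSchur w x
        + s * (∑ a, ∑ b, ∑ c, (δ a * x b * x c + x a * δ b * x c + x a * x b * δ c) * K a b c)
        + s ^ 2 * ((∑ a, ∑ b, ∑ c, (δ a * δ b * x c) * K a b c)
          + (∑ a, ∑ b, ∑ c, (δ a * x b * δ c) * K a b c)
          + (∑ a, ∑ b, ∑ c, (x a * δ b * δ c) * K a b c))
        + s ^ 3 * ∑ a, ∑ b, ∑ c, (δ a * δ b * δ c) * K a b c := by
        unfold graphSchur
        simp only [Finset.mul_sum, ← Finset.sum_add_distrib]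
        refine Finset.sum_congr rfl fun a _ => Finset.sum_congr rfl fun b _ =>
          Finset.sum_congr rfl fun c _ => ?_
        simp only [Pi.add_apply, Pi.smul_apply, smul_eq_mul, K]
        ring
    _ = _ := by rw [e0, e1, e2, e3]; ring

theorem schur_three {x y z : ℝ} (hx : 0 ≤ x) (hy : 0 ≤ y) (hz : 0 ≤ z) :
    0 ≤ x * (x - y) * (x - z) + y * (y - x) * (y - z) + z * (z - x) * (z - y) := by
  have key : ∀ {x y z : ℝ}, 0 ≤ z → z ≤ y → y ≤ x →
      0 ≤ x * (x - y) * (x - z) + y * (y - x) * (y - z) + z * (z - x) * (z - y) := by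
    intro x y z hz hzy hyx
    have h1 : 0 ≤ (x - y) ^ 2 * (x + y - z) := mul_nonneg (sq_nonneg _) (by linarith)
    have h2 : 0 ≤ z * ((x - z) * (y - z)) :=
      mul_nonneg hz (mul_nonneg (by linarith) (by linarith))
    linarith
  rcases le_total x y with h1 | h1 <;> rcases le_total y z with h2 | h2 <;>
    rcases le_total x z with h3 | h3 <;>
    first
    | linarith [key hx h1 h2] | linarith [key hx h3 h2] | linarith [key hy h1 h3]
    | linarith [key hy h2 h3] | linarith [key hz h3 h1] | linarith [key hz h2 h1]

/-- Schur's inequality in any number of variables. Two variables whose sum is at most `5 / 9` of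
the total can be merged, which does not increase the right side; if there are none, then there are
at most three variables. -/
theorem schur_finset {ι : Type*} [DecidableEq ι] (S : Finset ι) (x : ι → ℝ)
    (hx : ∀ i ∈ S, 0 ≤ x i) {s : ℝ} (hs : ∑ i ∈ S, x i = s) :
    0 ≤ ∑ i ∈ S, x i * (s - 2 * x i) * (s - 3 * x i) := by
  induction hn : S.card using Nat.strong_induction_on generalizing S x with
  | _ n ih =>
  subst hn
  have hs0 : 0 ≤ s := hs ▸ Finset.sum_nonneg hx
  by_cases hm : ∃ i ∈ S, ∃ j ∈ S, i ≠ j ∧ x i + x j ≤ 5 / 9 * s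
  · obtain ⟨i, hi, j, hj, hij, hle⟩ := hm
    have hi' : i ∈ S.erase j := Finset.mem_erase.2 ⟨hij, hi⟩
    have hother : ∀ k ∈ (S.erase j).erase i, Function.update x i (x i + x j) k = x k := by
      intro k hk
      exact Function.update_of_ne (Finset.ne_of_mem_erase hk) _ _
    have h := ih (S.erase j).card (Finset.card_erase_lt_of_mem hj) (S.erase j)
      (Function.update x i (x i + x j)) ?_ ?_ rfl
    · rw [← Finset.add_sum_erase _ _ hi', Finset.sum_congr rfl fun k hk => by
        rw [hother k hk]] at h
      rw [← Finset.add_sum_erase _ _ hj, ← Finset.add_sum_erase _ _ hi']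
      rw [Function.update_self] at h
      have : 0 ≤ x i * x j * (5 / 9 * s - (x i + x j)) :=
        mul_nonneg (mul_nonneg (hx i hi) (hx j hj)) (by linarith)
      linarith
    · intro k hk
      by_cases hki : k = i
      · subst hki
        rw [Function.update_self]
        exact add_nonneg (hx _ hi) (hx _ hj)
      · rw [Function.update_of_ne hki]
        exact hx k (Finset.mem_of_mem_erase hk)
    · rw [← Finset.add_sum_erase _ _ hi', Finset.sum_congr rfl hother, Function.update_self, ← hs,
        ← Finset.add_sum_erase _ _ hj, ← Finset.add_sum_erase _ _ hi']
      ring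
  · push Not at hm
    have hcard : S.card < 4 := by
      by_contra! hc
      obtain ⟨U, hU, hU4⟩ := Finset.exists_subset_card_eq hc
      obtain ⟨a, b, c, d, hab, hac, had, hbc, hbd, hcd, rfl⟩ := Finset.card_eq_four.1 hU4
      have h1 := hm a (hU (by simp)) b (hU (by simp)) hab
      have h2 := hm c (hU (by simp)) d (hU (by simp)) hcd
      have h3 := Finset.sum_le_sum_of_subset_of_nonneg hU fun i hi _ => hx i hi
      rw [hs, Finset.sum_insert (by simp [hab, hac, had]), Finset.sum_insert (by simp [hbc, hbd]),
        Finset.sum_insert (by simp [hcd]), Finset.sum_singleton] at h3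
      linarith
    obtain h | h | h | h : S.card = 0 ∨ S.card = 1 ∨ S.card = 2 ∨ S.card = 3 := by omega
    · rw [Finset.card_eq_zero.1 h]
      simp
    · obtain ⟨a, rfl⟩ := Finset.card_eq_one.1 h
      simp only [Finset.sum_singleton] at hs ⊢
      subst hs
      have := hx a (by simp)
      have : 0 ≤ x a ^ 3 := by positivity
      nlinarith
    · obtain ⟨a, b, hab, rfl⟩ := Finset.card_eq_two.1 h
      rw [Finset.sum_pair hab] at hs ⊢
      subst hs
      have := mul_nonneg (add_nonneg (hx a (by simp)) (hx b (by simp))) (sq_nonneg (x a - x b))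
      nlinarith
    · obtain ⟨a, b, c, hab, hac, hbc, rfl⟩ := Finset.card_eq_three.1 h
      rw [Finset.sum_insert (by simp [hab, hac]), Finset.sum_pair hbc] at hs ⊢
      subst hs
      have := schur_three (hx a (by simp)) (hx b (by simp)) (hx c (by simp))
      linarith

/-- For a clique, the inequality is Schur's. -/
theorem graphSchur_nonneg_of_clique {ι : Type*} [Fintype ι] [DecidableEq ι] {w : Sym2 ι → ℝ}
    (hw : ∀ a, w s(a, a) = 0) {x : ι → ℝ} (hx : ∀ i, 0 ≤ x i)
    (h1 : ∀ i j, i ≠ j → x i ≠ 0 → x j ≠ 0 → w s(i, j) = 1) : 0 ≤ graphSchur w x := by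
  -- The kernel takes the value `1` on distinct triples, `- 2 / 3` if exactly two indices agree, and
  -- `2` if all three do.
  have hK : ∀ a b c, x a * x b * x c * graphSchurKernel w a b c
      = x a * x b * x c - 5 / 3 * ((if a = b then x a * x b * x c else 0)
        + (if b = c then x a * x b * x c else 0) + (if a = c then x a * x b * x c else 0))
        + 6 * (if a = b then if b = c then x a * x b * x c else 0 else 0) := by
    intro a b c
    by_cases ha : x a = 0
    · simp [ha]
    by_cases hb : x b = 0
    · simp [hb]
    by_cases hc : x c = 0
    · simp [hc]
    have hv : ∀ i j, x i ≠ 0 → x j ≠ 0 → w s(i, j) = if i = j then 0 else 1 := by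
      intro i j hi hj
      split_ifs with h
      · rw [h, hw]
      · exact h1 i j h hi hj
    rw [graphSchurKernel, hv a b ha hb, hv b c hb hc, hv a c ha hc]
    split_ifs with p q r <;> first | ring1 | (exfalso; subst_vars; simp_all)
  have e0 : ∑ a, ∑ b, x a * x b * ∑ c, x c = (∑ i, x i) ^ 3 := by
    simp only [← Finset.mul_sum, ← Finset.sum_mul]
    ring
  have e1 : ∑ a, ∑ b, ∑ c, (if a = b then x a * x b * x c else 0)
      = (∑ i, x i ^ 2) * ∑ i, x i := by
    rw [Finset.sum_mul]
    refine Finset.sum_congr rfl fun a _ => ?_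
    rw [Finset.sum_comm, Finset.mul_sum]
    refine Finset.sum_congr rfl fun c _ => ?_
    rw [Finset.sum_ite_eq]
    simp [sq]
  have e2 : ∑ a, ∑ b, ∑ c, (if b = c then x a * x b * x c else 0)
      = (∑ i, x i) * ∑ i, x i ^ 2 := by
    rw [Finset.sum_mul]
    refine Finset.sum_congr rfl fun a _ => ?_
    rw [Finset.mul_sum]
    refine Finset.sum_congr rfl fun b _ => ?_
    rw [Finset.sum_ite_eq]
    simp [sq, mul_assoc]
  have e3 : ∑ a, ∑ b, ∑ c, (if a = c then x a * x b * x c else 0)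
      = (∑ i, x i ^ 2) * ∑ i, x i := by
    rw [Finset.sum_mul]
    refine Finset.sum_congr rfl fun a _ => ?_
    rw [Finset.mul_sum]
    refine Finset.sum_congr rfl fun b _ => ?_
    rw [Finset.sum_ite_eq]
    simp only [Finset.mem_univ, if_true]
    ring
  have e4 : ∑ a, ∑ b, ∑ c, (if a = b then if b = c then x a * x b * x c else 0 else 0)
      = ∑ i, x i ^ 3 := by
    refine Finset.sum_congr rfl fun a _ => ?_
    rw [Finset.sum_comm]
    simp only [Finset.sum_ite_eq, Finset.mem_univ, if_true]
    ring
  have h := schur_finset Finset.univ x (fun i _ => hx i) rfl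
  refine h.trans_eq ?_
  unfold graphSchur
  simp only [hK, Finset.sum_add_distrib, Finset.sum_sub_distrib, ← Finset.mul_sum]
  rw [e0, e1, e2, e3, e4]
  obtain ⟨s, hs⟩ : ∃ s, ∑ i, x i = s := ⟨_, rfl⟩
  rw [hs]
  have : ∀ i, x i * (s - 2 * x i) * (s - 3 * x i)
      = s ^ 2 * x i - 5 * s * x i ^ 2 + 6 * x i ^ 3 := fun i => by ring
  simp only [this, Finset.sum_add_distrib, Finset.sum_sub_distrib, ← Finset.mul_sum]
  rw [hs]
  ring

theorem continuous_graphSchur {ι : Type*} [Fintype ι] (x : ι → ℝ) :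
    Continuous fun w : Sym2 ι → ℝ => graphSchur w x := by
  unfold graphSchur graphSchurKernel
  fun_prop

/-- The inequality of Schur for weighted graphs, by induction on the number of vertices of non-zero
weight. If two of these are not adjacent, then shifting weight between them until one is emptied
does not increase the form in one of the two directions (Zykov symmetrization). In general, take
edge weights that minimize the form for the given `x`. If an edge has a weight less than `1` there,
then the minimum is also attained with weight `0` for this edge, because the form is affine in it.
If there is no such edge, the graph is a clique. -/
theorem graphSchur_nonneg {ι : Type*} [Fintype ι] (w : Sym2 ι → ℝ)
    (hw : ∀ a, w s(a, a) = 0) (hw0 : ∀ e, 0 ≤ w e) (hw1 : ∀ e, w e ≤ 1) (x : ι → ℝ)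
    (hx : ∀ i, 0 ≤ x i) : 0 ≤ graphSchur w x := by
  classical
  induction hn : (Finset.univ.filter fun i => x i ≠ 0).card using Nat.strong_induction_on
    generalizing w x with
  | _ n ih =>
  subst hn
  have hzero : ∀ w : Sym2 ι → ℝ, (∀ a, w s(a, a) = 0) → (∀ e, 0 ≤ w e) → (∀ e, w e ≤ 1) →
      ∀ i j, i ≠ j → x i ≠ 0 → x j ≠ 0 → w s(i, j) = 0 → 0 ≤ graphSchur w x := by
    intro w hw hw0 hw1 i j hij hi hj hwij
    obtain ⟨D, hD⟩ := graphSchur_shift hw hwij x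
    have hempty : ∀ (y : ι → ℝ), (∀ a, 0 ≤ y a) → (∀ a, x a = 0 → y a = 0) →
        (∃ a, x a ≠ 0 ∧ y a = 0) → 0 ≤ graphSchur w y := by
      intro y hy hxy ⟨a, ha, hya⟩
      refine ih _ (Finset.card_lt_card ?_) w hw hw0 hw1 y hy rfl
      refine Finset.ssubset_iff_of_subset ?_ |>.2 ⟨a, by simpa using ha, by simpa using hya⟩
      intro b
      simp only [Finset.mem_filter, Finset.mem_univ, true_and]
      exact mt (hxy b)
    have hval : ∀ s a, (x + s • (Pi.single i 1 - Pi.single j 1 : ι → ℝ)) a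
        = if a = i then x i + s else if a = j then x j - s else x a := by
      intro s a
      by_cases h1 : a = i
      · subst h1
        simp [hij]
      · by_cases h2 : a = j
        · subst h2
          simp [h1, sub_eq_add_neg]
        · simp [h1, h2]
    have h1 := hempty (x + (x j) • (Pi.single i 1 - Pi.single j 1 : ι → ℝ))
      (fun a => by rw [hval]; have := hx i; have := hx j; have := hx a; split_ifs <;> linarith)
      (fun a ha => by
        rw [hval, if_neg (by rintro rfl; exact hi ha), if_neg (by rintro rfl; exact hj ha), ha])
      ⟨j, hj, by rw [hval, if_neg hij.symm, if_pos rfl, sub_self]⟩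
    have h2 := hempty (x + (-x i) • (Pi.single i 1 - Pi.single j 1 : ι → ℝ))
      (fun a => by rw [hval]; have := hx i; have := hx j; have := hx a; split_ifs <;> linarith)
      (fun a ha => by
        rw [hval, if_neg (by rintro rfl; exact hi ha), if_neg (by rintro rfl; exact hj ha), ha])
      ⟨i, hi, by rw [hval, if_pos rfl, add_neg_cancel]⟩
    rw [hD] at h1 h2
    have hi' := lt_of_le_of_ne (hx i) (Ne.symm hi)
    have hj' := lt_of_le_of_ne (hx j) (Ne.symm hj)
    by_contra! hneg
    nlinarith
  -- The compact set of all edge weights in `[0, 1]` without loops.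
  let C : Set (Sym2 ι → ℝ) := Set.univ.pi fun e => Set.Icc 0 (if e.IsDiag then 0 else 1)
  have hC : IsCompact C := isCompact_univ_pi fun e => isCompact_Icc
  have hmemC : ∀ w : Sym2 ι → ℝ, w ∈ C ↔
      (∀ a, w s(a, a) = 0) ∧ (∀ e, 0 ≤ w e) ∧ (∀ e, w e ≤ 1) := by
    intro w
    simp only [C, Set.mem_univ_pi, Set.mem_Icc]
    constructor
    · intro h
      refine ⟨fun a => ?_, fun e => (h e).1, fun e => (h e).2.trans (by split_ifs <;> simp)⟩
      have := h s(a, a)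
      simp only [Sym2.mk_isDiag_iff, if_true] at this
      exact le_antisymm this.2 this.1
    · rintro ⟨h1, h2, h3⟩ e
      refine ⟨h2 e, ?_⟩
      split_ifs with he
      · induction e with
        | _ a b =>
        rw [Sym2.mk_isDiag_iff] at he
        subst he
        exact (h1 a).le
      · exact h3 e
  obtain ⟨v, hv, hmin⟩ := hC.exists_isMinOn ⟨w, (hmemC w).2 ⟨hw, hw0, hw1⟩⟩
    (continuous_graphSchur x).continuousOn
  refine le_trans ?_ (hmin ((hmemC w).2 ⟨hw, hw0, hw1⟩))
  obtain ⟨hvd, hv0, hv1⟩ := (hmemC v).1 hv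
  by_cases hclique : ∀ i j, i ≠ j → x i ≠ 0 → x j ≠ 0 → v s(i, j) = 1
  · exact graphSchur_nonneg_of_clique hvd hx hclique
  push Not at hclique
  obtain ⟨i, j, hij, hi, hj, hne⟩ := hclique
  have he : ¬ (s(i, j)).IsDiag := by rwa [Sym2.mk_isDiag_iff]
  have hupd : ∀ t : ℝ, 0 ≤ t → t ≤ 1 → Function.update v s(i, j) t ∈ C := by
    intro t ht0 ht1
    rw [hmemC]
    refine ⟨fun a => ?_, fun e => ?_, fun e => ?_⟩
    · rw [Function.update_of_ne, hvd]
      intro h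
      exact he (h ▸ Sym2.mk_isDiag_iff.2 rfl)
    · rw [Function.update_apply]
      split_ifs
      exacts [ht0, hv0 e]
    · rw [Function.update_apply]
      split_ifs
      exacts [ht1, hv1 e]
  have h1 : graphSchur v x ≤ graphSchur (Function.update v s(i, j) 1) x :=
    hmin (hupd 1 zero_le_one le_rfl)
  obtain ⟨k1, k2, k3⟩ := (hmemC _).1 (hupd 0 le_rfl zero_le_one)
  have h0 := hzero _ k1 k2 k3 i j hij hi hj (Function.update_self _ _ _)
  have h := graphSchur_update hvd he (v s(i, j)) x
  rw [Function.update_eq_self] at h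
  have hlt : v s(i, j) < 1 := lt_of_le_of_ne (hv1 _) hne
  have hnn := hv0 s(i, j)
  by_contra! hneg
  nlinarith

/-! ### Bounded measurable functions -/

/-- A bounded measurable real function. -/
structure BddMeas {α : Type*} [MeasurableSpace α] (f : α → ℝ) : Prop where
  measurable : Measurable f
  bdd : ∃ C, ∀ x, |f x| ≤ C

namespace BddMeas

variable {α β : Type*} [MeasurableSpace α] [MeasurableSpace β] {f g : α → ℝ}

theorem integrable (hf : BddMeas f) (μ : Measure α) [IsFiniteMeasure μ] : Integrable f μ := by
  obtain ⟨C, hC⟩ := hf.bdd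
  exact Integrable.of_bound hf.measurable.aestronglyMeasurable C (Filter.Eventually.of_forall hC)

theorem const (c : ℝ) : BddMeas fun _ : α => c :=
  ⟨measurable_const, |c|, fun _ => le_rfl⟩

theorem add (hf : BddMeas f) (hg : BddMeas g) : BddMeas fun x => f x + g x := by
  obtain ⟨C, hC⟩ := hf.bdd
  obtain ⟨D, hD⟩ := hg.bdd
  exact ⟨hf.measurable.add hg.measurable, C + D,
    fun x => (abs_add_le _ _).trans (add_le_add (hC x) (hD x))⟩

theorem mul (hf : BddMeas f) (hg : BddMeas g) : BddMeas fun x => f x * g x := by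
  obtain ⟨C, hC⟩ := hf.bdd
  obtain ⟨D, hD⟩ := hg.bdd
  refine ⟨hf.measurable.mul hg.measurable, C * D, fun x => ?_⟩
  rw [abs_mul]
  exact mul_le_mul (hC x) (hD x) (abs_nonneg _) ((abs_nonneg _).trans (hC x))

theorem const_mul (hf : BddMeas f) (c : ℝ) : BddMeas fun x => c * f x := (const c).mul hf

theorem sub (hf : BddMeas f) (hg : BddMeas g) : BddMeas fun x => f x - g x := by
  simpa [sub_eq_add_neg] using hf.add (hg.const_mul (-1))

theorem comp (hf : BddMeas f) {φ : β → α} (hφ : Measurable φ) : BddMeas fun y => f (φ y) := by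
  obtain ⟨C, hC⟩ := hf.bdd
  exact ⟨hf.measurable.comp hφ, C, fun y => hC _⟩

theorem finset_prod {ι : Type*} (s : Finset ι) {f : ι → α → ℝ} (hf : ∀ i ∈ s, BddMeas (f i)) :
    BddMeas fun x => ∏ i ∈ s, f i x := by
  classical
  induction s using Finset.induction_on with
  | empty => simpa using const 1
  | insert i s hi ih =>
    simp only [Finset.prod_insert hi]
    exact (hf i (by simp)).mul (ih fun j hj => hf j (by simp [hj]))

theorem finset_sum {ι : Type*} (s : Finset ι) {f : ι → α → ℝ} (hf : ∀ i ∈ s, BddMeas (f i)) :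
    BddMeas fun x => ∑ i ∈ s, f i x := by
  classical
  induction s using Finset.induction_on with
  | empty => simpa using const 0
  | insert i s hi ih =>
    simp only [Finset.sum_insert hi]
    exact (hf i (by simp)).add (ih fun j hj => hf j (by simp [hj]))

theorem integral_right {f : α × β → ℝ} (hf : BddMeas f) (μ : Measure β) [IsProbabilityMeasure μ] :
    BddMeas fun x => ∫ y, f (x, y) ∂μ := by
  obtain ⟨C, hC⟩ := hf.bdd
  refine ⟨(StronglyMeasurable.integral_prod_right (f := fun x y => f (x, y))
    hf.measurable.stronglyMeasurable).measurable, C, fun x => ?_⟩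
  have := norm_integral_le_of_norm_le_const (μ := μ) (f := fun y => f (x, y)) (C := C)
    (Filter.Eventually.of_forall fun y => hC _)
  simpa using this

theorem log (hf : BddMeas f) {ε : ℝ} (hε : 0 < ε) (h : ∀ x, ε ≤ f x) :
    BddMeas fun x => Real.log (f x) := by
  obtain ⟨C, hC⟩ := hf.bdd
  refine ⟨hf.measurable.log, |Real.log ε| + |Real.log C|, fun x => ?_⟩
  have h1 := Real.log_le_log hε (h x)
  have h2 := Real.log_le_log (hε.trans_le (h x)) ((le_abs_self _).trans (hC x))
  rw [abs_le]
  constructor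
  · linarith [neg_abs_le (Real.log ε), abs_nonneg (Real.log C)]
  · linarith [le_abs_self (Real.log C), abs_nonneg (Real.log ε)]

theorem inv (hf : BddMeas f) {ε : ℝ} (hε : 0 < ε) (h : ∀ x, ε ≤ f x) :
    BddMeas fun x => (f x)⁻¹ := by
  refine ⟨hf.measurable.inv, ε⁻¹, fun x => ?_⟩
  rw [abs_of_pos (inv_pos.2 (hε.trans_le (h x)))]
  exact inv_anti₀ hε (h x)

theorem integral_swap {f : α → β → ℝ} (hf : BddMeas (Function.uncurry f)) (μ : Measure α)
    (ν : Measure β) [IsProbabilityMeasure μ] [IsProbabilityMeasure ν] :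
    ∫ x, ∫ y, f x y ∂ν ∂μ = ∫ y, ∫ x, f x y ∂μ ∂ν :=
  integral_integral_swap (hf.integrable _)

theorem integral2_add {f g : unitInterval → unitInterval → ℝ}
    (hf : BddMeas (Function.uncurry f)) (hg : BddMeas (Function.uncurry g)) :
    ∫ x, ∫ y, (f x y + g x y) = (∫ x, ∫ y, f x y) + ∫ x, ∫ y, g x y :=
  integral_integral_add (hf.integrable _) (hg.integrable _)

theorem integral2_sub {f g : unitInterval → unitInterval → ℝ}
    (hf : BddMeas (Function.uncurry f)) (hg : BddMeas (Function.uncurry g)) :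
    ∫ x, ∫ y, (f x y - g x y) = (∫ x, ∫ y, f x y) - ∫ x, ∫ y, g x y :=
  integral_integral_sub (hf.integrable _) (hg.integrable _)

end BddMeas

/-! ### Integrals over a cube with finitely many coordinates -/

section Resample

variable {X : Type*} [Fintype X]

theorem measurePreserving_update [DecidableEq X] (v : X) :
    MeasurePreserving (fun p : (X → unitInterval) × unitInterval => Function.update p.1 v p.2) := by
  refine ⟨by fun_prop, ?_⟩
  symm
  refine Measure.pi_eq fun s hs => ?_
  rw [Measure.map_apply (by fun_prop) (MeasurableSet.univ_pi hs)]
  have : (fun p : (X → unitInterval) × unitInterval => Function.update p.1 v p.2) ⁻¹' Set.univ.pi s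
      = (Set.univ.pi (Function.update s v Set.univ)) ×ˢ (s v) := by
    ext ⟨x, y⟩
    simp only [Set.mem_preimage, Set.mem_univ_pi, Set.mem_prod]
    constructor
    · intro h
      refine ⟨fun i => ?_, by simpa using h v⟩
      by_cases hi : i = v
      · subst hi; simp
      · simpa [hi] using h i
    · rintro ⟨h, hv⟩ i
      by_cases hi : i = v
      · subst hi; simpa using hv
      · simpa [hi] using h i
  rw [this, Measure.volume_eq_prod, Measure.prod_prod, volume_pi, Measure.pi_pi,
    ← Finset.prod_erase_mul _ _ (Finset.mem_univ v),
    ← Finset.prod_erase_mul _ _ (Finset.mem_univ v)]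
  simp only [Function.update_self, measure_univ, mul_one]
  congr 1
  refine Finset.prod_congr rfl fun i hi => ?_
  rw [Function.update_of_ne (Finset.ne_of_mem_erase hi)]

/-- Resampling one coordinate does not change the integral over the cube. -/
theorem integral_eq_integral_update [DecidableEq X] (v : X) {f : (X → unitInterval) → ℝ}
    (hf : BddMeas f) : ∫ x, f x = ∫ x, ∫ y, f (Function.update x v y) := by
  have h := measurePreserving_update v
  conv_lhs => rw [← h.map_eq]
  rw [integral_map h.measurable.aemeasurable hf.measurable.aestronglyMeasurable,
    Measure.volume_eq_prod, integral_prod]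
  exact (hf.comp h.measurable).integrable _

theorem integral_eval (a : X) {g : unitInterval → ℝ} (hg : BddMeas g) :
    ∫ x : X → unitInterval, g (x a) = ∫ u, g u := by
  have h := measurePreserving_eval (fun _ : X => (volume : Measure unitInterval)) a
  rw [← h.map_eq, integral_map h.measurable.aemeasurable hg.measurable.aestronglyMeasurable]
  rfl

theorem integral_eval_pair {a b : X} (hab : a ≠ b) {g : unitInterval → unitInterval → ℝ}
    (hg : BddMeas (Function.uncurry g)) :
    ∫ x : X → unitInterval, g (x a) (x b) = ∫ u, ∫ v, g u v := by
  classical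
  rw [integral_eq_integral_update b (f := fun x => g (x a) (x b))
    (hg.comp (φ := fun x : X → unitInterval => (x a, x b)) (by fun_prop))]
  simp only [Function.update_self, Function.update_of_ne hab]
  exact integral_eval a (hg.integral_right volume)

theorem integral_eval_triple {a b c : X} (hab : a ≠ b) (hac : a ≠ c) (hbc : b ≠ c)
    {g : unitInterval → unitInterval → unitInterval → ℝ}
    (hg : BddMeas fun p : (unitInterval × unitInterval) × unitInterval => g p.1.1 p.1.2 p.2) :
    ∫ x : X → unitInterval, g (x a) (x b) (x c) = ∫ u, ∫ v, ∫ w, g u v w := by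
  classical
  rw [integral_eq_integral_update c (f := fun x => g (x a) (x b) (x c))
    (hg.comp (φ := fun x : X → unitInterval => ((x a, x b), x c)) (by fun_prop))]
  simp only [Function.update_self, Function.update_of_ne hac, Function.update_of_ne hbc]
  exact integral_eval_pair (g := fun u v => ∫ w, g u v w) hab (hg.integral_right volume)

end Resample

/-! ### The bounds of Goodman and Bollobás -/

namespace Graphon

variable (W : Graphon)

theorem bddMeas : BddMeas (Function.uncurry W.toFun) :=
  ⟨W.measurable', 1, fun p => by
    rw [Function.uncurry, abs_of_nonneg (W.nonneg' _ _)]; exact W.le_one' _ _⟩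

theorem bddMeas_comp {α : Type*} [MeasurableSpace α] {φ ψ : α → unitInterval} (hφ : Measurable φ)
    (hψ : Measurable ψ) : BddMeas fun a => W.toFun (φ a) (ψ a) :=
  W.bddMeas.comp (hφ.prodMk hψ)

/-- The edge density `∫∫ W(x, y)`. -/
noncomputable def edgeDensity : ℝ := ∫ x, ∫ y, W.toFun x y

/-- The degree `∫ W(x, y) dy`. -/
noncomputable def degree (x : unitInterval) : ℝ := ∫ y, W.toFun x y

/-- The codegree `∫ W(x, z) W(y, z) dz`. -/
noncomputable def codegree (x y : unitInterval) : ℝ := ∫ z, W.toFun x z * W.toFun y z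

/-- The triangle density `∫∫∫ W(x, y) W(x, z) W(y, z)`. -/
noncomputable def triangleDensity : ℝ := ∫ x, ∫ y, W.toFun x y * W.codegree x y

theorem bddMeas_degree : BddMeas W.degree := W.bddMeas.integral_right volume

theorem bddMeas_codegree : BddMeas (Function.uncurry W.codegree) :=
  BddMeas.integral_right (f := fun p : (unitInterval × unitInterval) × unitInterval =>
    W.toFun p.1.1 p.2 * W.toFun p.1.2 p.2)
    ((W.bddMeas_comp (by fun_prop) (by fun_prop)).mul
      (W.bddMeas_comp (by fun_prop) (by fun_prop))) volume

theorem bddMeas_codegree_comp {α : Type*} [MeasurableSpace α] {φ ψ : α → unitInterval}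
    (hφ : Measurable φ) (hψ : Measurable ψ) : BddMeas fun a => W.codegree (φ a) (ψ a) :=
  W.bddMeas_codegree.comp (hφ.prodMk hψ)

theorem codegree_comm (x y : unitInterval) : W.codegree x y = W.codegree y x := by
  simp only [codegree, mul_comm]

theorem codegree_nonneg (x y : unitInterval) : 0 ≤ W.codegree x y :=
  integral_nonneg fun _ => mul_nonneg (W.nonneg' _ _) (W.nonneg' _ _)

theorem edgeDensity_nonneg : 0 ≤ W.edgeDensity :=
  integral_nonneg fun _ => integral_nonneg fun _ => W.nonneg' _ _

theorem triangleDensity_nonneg : 0 ≤ W.triangleDensity :=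
  integral_nonneg fun _ => integral_nonneg fun _ =>
    mul_nonneg (W.nonneg' _ _) (W.codegree_nonneg _ _)

theorem triangleDensity_eq :
    W.triangleDensity = ∫ x, ∫ y, ∫ z, W.toFun x y * (W.toFun x z * W.toFun y z) := by
  simp only [triangleDensity, codegree, integral_const_mul]

theorem edgeDensity_compl : W.compl.edgeDensity = 1 - W.edgeDensity := by
  have h : ∀ x, ∫ y, W.compl.toFun x y = 1 - W.degree x := by
    intro x
    simp only [compl, degree]
    rw [integral_sub (integrable_const _)
      (BddMeas.integrable (W.bddMeas_comp (φ := fun _ => x) (ψ := fun y => y) measurable_const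
        measurable_id) _)]
    simp
  simp only [edgeDensity, h]
  rw [integral_sub (integrable_const _) (W.bddMeas_degree.integrable _)]
  simp [degree]

theorem compl_compl : W.compl.compl = W := by
  cases W
  simp [compl]

theorem edgeDensity_sq_le : W.edgeDensity ^ 2 ≤ ∫ x, W.degree x ^ 2 := by
  have h0 : 0 ≤ ∫ x, (W.degree x - W.edgeDensity) ^ 2 := integral_nonneg fun _ => sq_nonneg _
  have h1 : ∫ x, (W.degree x - W.edgeDensity) ^ 2
      = ∫ x, (W.degree x ^ 2 - (2 * W.edgeDensity * W.degree x - W.edgeDensity ^ 2)) := by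
    congr 1 with x
    ring
  have hd := W.bddMeas_degree
  have hsq : BddMeas fun x => W.degree x ^ 2 := by simpa [sq] using hd.mul hd
  rw [h1, integral_sub (hsq.integrable _)
    (((hd.const_mul _).sub (BddMeas.const _)).integrable _),
    integral_sub ((hd.const_mul _).integrable _) (integrable_const _), integral_const_mul] at h0
  have h2 : ∫ x, W.degree x = W.edgeDensity := rfl
  simp only [h2, integral_const, probReal_univ, one_smul] at h0
  nlinarith

/-- Goodman's bound. Expanding the triangle density of `1 - W`, one finds that the sum of the two
densities is `1 - 3 p + 3 ∫ d ^ 2`, where `p` is the edge density and `d` the degree. -/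
theorem goodman : 1 - 3 * W.edgeDensity + 3 * W.edgeDensity ^ 2
    ≤ W.triangleDensity + W.compl.triangleDensity := by
  let S := ∫ x, W.degree x ^ 2
  have hm : ∀ {φ ψ : (unitInterval × unitInterval) × unitInterval → unitInterval},
      Measurable φ → Measurable ψ → BddMeas fun p => W.toFun (φ p) (ψ p) :=
    fun h1 h2 => W.bddMeas_comp h1 h2
  have hd : ∀ x, ∫ y, W.toFun x y = W.degree x := fun _ => rfl
  have hc : ∀ x y, W.compl.codegree x y = 1 - W.degree x - W.degree y + W.codegree x y := by
    intro x y
    have b1 : BddMeas fun z => W.toFun x z := W.bddMeas_comp measurable_const measurable_id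
    have b2 : BddMeas fun z => W.toFun y z := W.bddMeas_comp measurable_const measurable_id
    calc W.compl.codegree x y
        = ∫ z, (1 - W.toFun x z - W.toFun y z + W.toFun x z * W.toFun y z) := by
          simp only [codegree, compl]
          congr 1 with z
          ring
      _ = _ := by
          rw [integral_add ((((BddMeas.const 1).sub b1).sub b2).integrable _)
            ((b1.mul b2).integrable _), integral_sub (((BddMeas.const 1).sub b1).integrable _)
            (b2.integrable _), integral_sub (integrable_const _) (b1.integrable _)]
          simp [degree, codegree]
  have e1 : ∫ x, ∫ y, W.toFun x y * W.degree x = S := by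
    simp only [integral_mul_const, hd, S, sq]
  have e2 : ∫ x, ∫ y, W.toFun x y * W.degree y = S := by
    rw [BddMeas.integral_swap ((W.bddMeas_comp measurable_fst measurable_snd).mul
      (W.bddMeas_degree.comp measurable_snd))]
    simp only [W.symm' _, integral_mul_const]
    simp only [hd, S, sq]
  have e3 : ∫ x, ∫ y, W.codegree x y = S := by
    have : ∀ x, ∫ y, W.codegree x y = ∫ z, W.toFun x z * W.degree z := by
      intro x
      simp only [codegree]
      rw [BddMeas.integral_swap ((W.bddMeas_comp measurable_const measurable_snd).mul
        (W.bddMeas_comp measurable_fst measurable_snd))]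
      simp only [integral_const_mul, degree, W.symm' _]
    simp only [this, e2]
  have bx : BddMeas (Function.uncurry fun x _ : unitInterval => W.degree x) :=
    W.bddMeas_degree.comp measurable_fst
  have by' : BddMeas (Function.uncurry fun _ y : unitInterval => W.degree y) :=
    W.bddMeas_degree.comp measurable_snd
  have h : W.compl.triangleDensity = 1 - 3 * W.edgeDensity + 3 * S - W.triangleDensity := by
    calc W.compl.triangleDensity
        = ∫ x, ∫ y, (((1 - W.degree x - W.degree y + W.codegree x y - W.toFun x y)
            + W.toFun x y * W.degree x + W.toFun x y * W.degree y)
            - W.toFun x y * W.codegree x y) := by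
          simp only [triangleDensity, hc]
          congr 1 with x
          congr 1 with y
          simp only [compl]
          ring
      _ = _ := by
          have b0 := BddMeas.const (α := unitInterval × unitInterval) 1
          rw [BddMeas.integral2_sub, BddMeas.integral2_add, BddMeas.integral2_add,
            BddMeas.integral2_sub, BddMeas.integral2_add, BddMeas.integral2_sub,
            BddMeas.integral2_sub, e1, e2, e3]
          · simp only [integral_const, probReal_univ, one_smul]
            have : ∫ x, W.degree x = W.edgeDensity := rfl
            have h' : ∫ x, ∫ y, W.toFun x y = W.edgeDensity := rfl
            have h'' : ∫ x, ∫ y, W.toFun x y * W.codegree x y = W.triangleDensity := rfl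
            rw [this, h', h'']
            ring
          all_goals
            simp only [Function.uncurry_def]
            repeat' first
              | exact b0 | exact bx | exact by' | exact W.bddMeas | exact W.bddMeas_codegree
              | apply BddMeas.sub | apply BddMeas.add | apply BddMeas.mul
  rw [h]
  linarith [W.edgeDensity_sq_le]

open Classical in
/-- The edge weights of the `W`-random weighted graph on the sample `x`. Loops have weight `0`. -/
noncomputable def sampleWeight {n : ℕ} (x : Fin n → unitInterval) (e : Sym2 (Fin n)) : ℝ :=
  if e.IsDiag then 0 else W.onPair (e.map x)

theorem onPair_nonneg (e : Sym2 unitInterval) : 0 ≤ W.onPair e := by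
  induction e with
  | _ a b => exact W.nonneg' a b

theorem onPair_le_one (e : Sym2 unitInterval) : W.onPair e ≤ 1 := by
  induction e with
  | _ a b => exact W.le_one' a b

theorem sampleWeight_nonneg {n : ℕ} (x : Fin n → unitInterval) (e : Sym2 (Fin n)) :
    0 ≤ W.sampleWeight x e := by
  unfold sampleWeight
  split_ifs
  exacts [le_rfl, W.onPair_nonneg _]

theorem sampleWeight_le_one {n : ℕ} (x : Fin n → unitInterval) (e : Sym2 (Fin n)) :
    W.sampleWeight x e ≤ 1 := by
  unfold sampleWeight
  split_ifs
  exacts [zero_le_one, W.onPair_le_one _]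

theorem sampleWeight_self {n : ℕ} (x : Fin n → unitInterval) (a : Fin n) :
    W.sampleWeight x s(a, a) = 0 := by
  simp [sampleWeight]

theorem sampleWeight_of_ne {n : ℕ} (x : Fin n → unitInterval) {a b : Fin n} (h : a ≠ b) :
    W.sampleWeight x s(a, b) = W.toFun (x a) (x b) := by
  simp [sampleWeight, h, onPair]

theorem bddMeas_sampleWeight {n : ℕ} (e : Sym2 (Fin n)) :
    BddMeas fun x : Fin n → unitInterval => W.sampleWeight x e := by
  induction e with
  | _ a b =>
  by_cases h : a = b
  · subst h
    simpa [sampleWeight_self] using BddMeas.const 0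
  · simp only [W.sampleWeight_of_ne _ h]
    exact W.bddMeas_comp (by fun_prop) (by fun_prop)

theorem bddMeas_graphSchurKernel_sampleWeight {n : ℕ} (a b c : Fin n) :
    BddMeas fun x : Fin n → unitInterval => graphSchurKernel (W.sampleWeight x) a b c := by
  unfold graphSchurKernel
  have h := fun e => W.bddMeas_sampleWeight (n := n) e
  exact ((BddMeas.const 2).sub ((((h _).add (h _)).add (h _)).const_mul _)).add
    ((((h _).mul (h _)).mul (h _)).const_mul _)

theorem integral_graphSchurKernel_le {n : ℕ} (a b c : Fin n) :
    ∫ x : Fin n → unitInterval, graphSchurKernel (W.sampleWeight x) a b c ≤ 5 := by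
  have h : ∀ x : Fin n → unitInterval, graphSchurKernel (W.sampleWeight x) a b c ≤ 5 := by
    intro x
    unfold graphSchurKernel
    have h0 := W.sampleWeight_nonneg x
    have h1 := W.sampleWeight_le_one x
    have : W.sampleWeight x s(a, b) * W.sampleWeight x s(b, c) * W.sampleWeight x s(a, c) ≤ 1 :=
      mul_le_one₀ (mul_le_one₀ (h1 _) (h0 _) (h1 _)) (h0 _) (h1 _)
    linarith [h0 s(a, b), h0 s(b, c), h0 s(a, c)]
  refine (integral_mono ((W.bddMeas_graphSchurKernel_sampleWeight a b c).integrable _)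
    (integrable_const 5) h).trans_eq ?_
  simp

theorem integral_graphSchurKernel_of_ne {n : ℕ} {a b c : Fin n} (hab : a ≠ b) (hac : a ≠ c)
    (hbc : b ≠ c) : ∫ x : Fin n → unitInterval, graphSchurKernel (W.sampleWeight x) a b c
      = 2 - 4 * W.edgeDensity + 3 * W.triangleDensity := by
  have h := fun e => W.bddMeas_sampleWeight (n := n) e
  have i1 : ∀ {a b : Fin n}, a ≠ b →
      ∫ x : Fin n → unitInterval, W.sampleWeight x s(a, b) = W.edgeDensity := by
    intro a b hab
    simp only [W.sampleWeight_of_ne _ hab]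
    exact integral_eval_pair hab W.bddMeas
  have i3 : ∫ x : Fin n → unitInterval,
      W.sampleWeight x s(a, b) * W.sampleWeight x s(b, c) * W.sampleWeight x s(a, c)
      = W.triangleDensity := by
    simp only [W.sampleWeight_of_ne _ hab, W.sampleWeight_of_ne _ hac, W.sampleWeight_of_ne _ hbc]
    rw [integral_eval_triple (g := fun u v w => W.toFun u v * W.toFun v w * W.toFun u w)
      hab hac hbc (((W.bddMeas_comp (by fun_prop) (by fun_prop)).mul
        (W.bddMeas_comp (by fun_prop) (by fun_prop))).mul
        (W.bddMeas_comp (by fun_prop) (by fun_prop))), triangleDensity_eq]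
    congr 1 with x
    congr 1 with y
    congr 1 with z
    ring
  unfold graphSchurKernel
  rw [integral_add
    (((BddMeas.const 2).sub ((((h _).add (h _)).add (h _)).const_mul _)).integrable _)
    (((((h _).mul (h _)).mul (h _)).const_mul _).integrable _),
    integral_sub (integrable_const _) (((((h _).add (h _)).add (h _)).const_mul _).integrable _),
    integral_const_mul, integral_const_mul,
    integral_add (((h _).add (h _)).integrable _) ((h _).integrable _),
    integral_add ((h _).integrable _) ((h _).integrable _), i1 hab, i1 hac, i1 hbc, i3]
  simp
  ring

/-- Bollobás's bound: the pair of edge density and triangle density lies above the line through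
`(1 / 2, 0)` and `(2 / 3, 2 / 9)`, the pairs of the balanced complete bipartite and tripartite
graphons. It is the mean of `graphSchur_nonneg` over a sample of `n` vertices of weight `1`, in the
limit `n → ∞`. -/
theorem bollobas : 4 * W.edgeDensity - 2 ≤ 3 * W.triangleDensity := by
  set D := 2 - 4 * W.edgeDensity + 3 * W.triangleDensity with hD
  -- At most `3 n ^ 2` of the `n ^ 3` triples have two equal entries.
  have key : ∀ n : ℕ, 0 ≤ (n : ℝ) ^ 3 * D + 3 * (n : ℝ) ^ 2 * (5 + |D|) := by
    intro n
    have h0 : 0 ≤ ∫ x : Fin n → unitInterval, graphSchur (W.sampleWeight x) (fun _ => 1) :=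
      integral_nonneg fun x => graphSchur_nonneg _ (W.sampleWeight_self x)
        (W.sampleWeight_nonneg x) (W.sampleWeight_le_one x) _ fun _ => zero_le_one
    have hb := fun a b c => W.bddMeas_graphSchurKernel_sampleWeight (n := n) a b c
    simp only [graphSchur, one_mul] at h0
    rw [integral_finsetSum _ fun a _ => (BddMeas.finset_sum _ fun b _ =>
      BddMeas.finset_sum _ fun c _ => hb a b c).integrable _] at h0
    simp only [integral_finsetSum _ fun b _ => (BddMeas.finset_sum _ fun c _ =>
      hb _ b c).integrable _, integral_finsetSum _ fun c _ => (hb _ _ c).integrable _] at h0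
    have hle : ∀ a b c : Fin n,
        ∫ x : Fin n → unitInterval, graphSchurKernel (W.sampleWeight x) a b c
        ≤ D + (5 + |D|) * ((if a = b then 1 else 0) + (if a = c then 1 else 0)
          + (if b = c then 1 else 0)) := by
      intro a b c
      by_cases h : a ≠ b ∧ a ≠ c ∧ b ≠ c
      · rw [W.integral_graphSchurKernel_of_ne h.1 h.2.1 h.2.2]
        simp [h.1, h.2.1, h.2.2, hD]
      · refine (W.integral_graphSchurKernel_le a b c).trans ?_
        have h1 : (1 : ℝ) ≤ (if a = b then 1 else 0) + (if a = c then 1 else 0)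
            + (if b = c then 1 else 0) := by
          split_ifs <;> simp_all
        have h2 : 0 ≤ 5 + |D| := by positivity
        have := mul_le_mul_of_nonneg_left h1 h2
        linarith [neg_abs_le D]
    refine (h0.trans (Finset.sum_le_sum fun a _ => Finset.sum_le_sum fun b _ =>
      Finset.sum_le_sum fun c _ => hle a b c)).trans_eq ?_
    simp only [Finset.sum_add_distrib, ← Finset.mul_sum, Finset.sum_ite_eq, Finset.mem_univ,
      if_true, Finset.sum_const, Finset.card_univ, Fintype.card_fin, nsmul_eq_mul, mul_ite,
      mul_one, mul_zero]
    ring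
  by_contra! hneg
  have hD0 : 0 < -D := by linarith
  obtain ⟨n, hn⟩ := exists_nat_gt (3 * (5 + |D|) / -D)
  rw [div_lt_iff₀ hD0] at hn
  have hn0 : (0 : ℝ) < n := by
    rcases Nat.eq_zero_or_pos n with h | h
    · subst h
      simp only [Nat.cast_zero, zero_mul] at hn
      linarith [abs_nonneg D]
    · exact_mod_cast h
  have h1 := key n
  have h2 : 0 < (n : ℝ) ^ 2 * (n * -D - 3 * (5 + |D|)) := mul_pos (by positivity) (by linarith)
  linarith

end Graphon

/-! ### Logarithmic bounds for graphons that are bounded away from zero -/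

namespace Graphon

/-- The weight `∫ W(x, y) c(x, y) dy` of the triangles at `x`, where `c` is the codegree. -/
noncomputable def triangleDegree (W : Graphon) (x : unitInterval) : ℝ :=
  ∫ y, W.toFun x y * W.codegree x y

/-- The mean of the logarithm of the codegree of an edge of a random triangle. -/
noncomputable def meanLogCodegree (W : Graphon) : ℝ :=
  ∫ x, ∫ y, W.toFun x y * W.codegree x y / W.triangleDensity * Real.log (W.codegree x y)

section LowerBound

variable (W : Graphon)

theorem bddMeas_triangleDegree : BddMeas W.triangleDegree :=
  BddMeas.integral_right (f := fun p : unitInterval × unitInterval =>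
    W.toFun p.1 p.2 * W.codegree p.1 p.2) (W.bddMeas.mul W.bddMeas_codegree) volume

theorem integral_triangleDegree : ∫ x, W.triangleDegree x = W.triangleDensity := rfl

variable {W} {ε : ℝ}

theorem le_integral_of_forall {f : unitInterval → ℝ} (hf : BddMeas f) {c : ℝ} (h : ∀ x, c ≤ f x) :
    c ≤ ∫ x, f x := by
  have := integral_mono (μ := (volume : Measure unitInterval)) (integrable_const c)
    (hf.integrable _) h
  simpa using this

theorem sq_le_codegree (hε : 0 ≤ ε) (hW : ∀ x y, ε ≤ W.toFun x y) (x y : unitInterval) :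
    ε ^ 2 ≤ W.codegree x y :=
  le_integral_of_forall ((W.bddMeas_comp measurable_const measurable_id).mul
    (W.bddMeas_comp measurable_const measurable_id)) fun z => by
      rw [sq]
      exact mul_le_mul (hW x z) (hW y z) hε (W.nonneg' _ _)

theorem cube_le_triangleDegree (hε : 0 ≤ ε) (hW : ∀ x y, ε ≤ W.toFun x y) (x : unitInterval) :
    ε ^ 3 ≤ W.triangleDegree x :=
  le_integral_of_forall ((W.bddMeas_comp measurable_const measurable_id).mul
    (W.bddMeas_codegree_comp measurable_const measurable_id)) fun y => by
      rw [pow_succ']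
      exact mul_le_mul (hW _ _) (sq_le_codegree hε hW _ _) (by positivity) (W.nonneg' _ _)

theorem triangleDensity_pos (hε : 0 < ε) (hW : ∀ x y, ε ≤ W.toFun x y) :
    0 < W.triangleDensity :=
  (pow_pos hε 3).trans_le
    (le_integral_of_forall W.bddMeas_triangleDegree (cube_le_triangleDegree hε.le hW))

theorem edgeDensity_pos (hε : 0 < ε) (hW : ∀ x y, ε ≤ W.toFun x y) : 0 < W.edgeDensity :=
  hε.trans_le (le_integral_of_forall W.bddMeas_degree fun x =>
    le_integral_of_forall (W.bddMeas_comp measurable_const measurable_id) (hW x))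

/-- The tangent inequality for the convex function `x log x` at `r`. -/
theorem mul_log_tangent {x r : ℝ} (hx : 0 < x) (hr : 0 < r) :
    x * Real.log r + x - r ≤ x * Real.log x := by
  have h := Real.log_le_sub_one_of_pos (div_pos hr hx)
  rw [Real.log_div hr.ne' hx.ne'] at h
  have h2 := mul_le_mul_of_nonneg_left h hx.le
  have h3 : x * (r / x - 1) = r - x := by field_simp
  linarith

/-- Jensen's inequality for `x log x` and the triangle degree: the relative entropy of the
distribution of a vertex of a random triangle is non-negative. -/
theorem log_triangleDensity_le (hε : 0 < ε) (hW : ∀ x y, ε ≤ W.toFun x y) :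
    Real.log W.triangleDensity
      ≤ ∫ x, W.triangleDegree x / W.triangleDensity * Real.log (W.triangleDegree x) := by
  have ht := triangleDensity_pos hε hW
  have hT := W.bddMeas_triangleDegree
  have hlog := hT.log (pow_pos hε 3) (cube_le_triangleDegree hε.le hW)
  set t := W.triangleDensity with ht'
  have e : ∫ x, W.triangleDegree x / t * Real.log (W.triangleDegree x)
      = t⁻¹ * ∫ x, W.triangleDegree x * Real.log (W.triangleDegree x) := by
    rw [← integral_const_mul]
    congr 1 with x
    ring
  have h := integral_mono (μ := (volume : Measure unitInterval))
    (((hT.mul (BddMeas.const (Real.log t))).add (hT.sub (BddMeas.const t))).integrable _)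
    ((hT.mul hlog).integrable _) fun x => by
      have := mul_log_tangent ((pow_pos hε 3).trans_le (cube_le_triangleDegree hε.le hW x)) ht
      dsimp only
      linarith
  rw [integral_add ((hT.mul (BddMeas.const _)).integrable _)
    ((hT.sub (BddMeas.const _)).integrable _), integral_sub (hT.integrable _) (integrable_const _),
    integral_mul_const, integral_triangleDegree] at h
  simp only [integral_const, probReal_univ, one_smul, ← ht'] at h
  rw [e, inv_mul_eq_div, le_div_iff₀ ht]
  linarith

/-- Jensen's inequality for `x log x` and the codegree of a random edge, whose mean is the quotient
of the triangle density by the edge density. -/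
theorem log_sub_log_le_meanLogCodegree (hε : 0 < ε) (hW : ∀ x y, ε ≤ W.toFun x y) :
    Real.log W.triangleDensity - Real.log W.edgeDensity ≤ W.meanLogCodegree := by
  have ht := triangleDensity_pos hε hW
  have hp := edgeDensity_pos hε hW
  have hc := W.bddMeas_codegree
  have hcpos : ∀ x y, 0 < W.codegree x y := fun x y =>
    (pow_pos hε 2).trans_le (sq_le_codegree hε.le hW x y)
  have hlog : BddMeas (Function.uncurry fun x y => Real.log (W.codegree x y)) :=
    hc.log (pow_pos hε 2) fun p => sq_le_codegree hε.le hW p.1 p.2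
  rw [← Real.log_div ht.ne' hp.ne']
  set r := W.triangleDensity / W.edgeDensity with hr
  have hr0 : 0 < r := div_pos ht hp
  have e : W.meanLogCodegree = W.triangleDensity⁻¹
      * ∫ x, ∫ y, W.toFun x y * W.codegree x y * Real.log (W.codegree x y) := by
    simp only [← integral_const_mul, meanLogCodegree]
    congr 1 with x
    congr 1 with y
    ring
  have b1 : BddMeas (Function.uncurry fun x y => W.toFun x y * W.codegree x y) :=
    W.bddMeas.mul hc
  have b2 : BddMeas (Function.uncurry fun x y =>
      W.toFun x y * W.codegree x y * Real.log (W.codegree x y)) := b1.mul hlog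
  have b3 : BddMeas (Function.uncurry fun x y => Real.log r * (W.toFun x y * W.codegree x y)) :=
    b1.const_mul _
  have b4 : BddMeas (Function.uncurry fun x y => r * W.toFun x y) := W.bddMeas.const_mul _
  have b5 : BddMeas (Function.uncurry fun x y =>
      Real.log r * (W.toFun x y * W.codegree x y) + W.toFun x y * W.codegree x y) := b3.add b1
  have h : ∫ x, ∫ y, (Real.log r * (W.toFun x y * W.codegree x y) + W.toFun x y * W.codegree x y
        - r * W.toFun x y)
      ≤ ∫ x, ∫ y, W.toFun x y * W.codegree x y * Real.log (W.codegree x y) := by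
    refine integral_mono ((BddMeas.integral_right (b5.sub b4) volume).integrable _)
      ((b2.integral_right volume).integrable _) fun x => integral_mono
      (((b5.sub b4).comp measurable_prodMk_left).integrable _)
      ((b2.comp measurable_prodMk_left).integrable _) fun y => ?_
    have := mul_le_mul_of_nonneg_left (mul_log_tangent (hcpos x y) hr0) (W.nonneg' x y)
    dsimp only
    linarith
  rw [BddMeas.integral2_sub b5 b4, BddMeas.integral2_add b3 b1] at h
  simp only [integral_const_mul] at h
  have h1 : ∫ x, ∫ y, W.toFun x y * W.codegree x y = W.triangleDensity := rfl
  have h2 : ∫ x, ∫ y, W.toFun x y = W.edgeDensity := rfl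
  rw [h1, h2, hr, div_mul_cancel₀ _ hp.ne', ← hr] at h
  rw [e, inv_mul_eq_div, le_div_iff₀ ht]
  linarith

end LowerBound

end Graphon

/-! ### Graphs built from edges and triangles -/

/-- Graphs with vertex set `Y` and edge set `E` that are built by adding one vertex at a time (or
two, the ends of a new edge): an isolated vertex, an isolated edge, a pendant edge at a non-isolated
vertex, or a vertex adjacent to both ends of an edge. The number of steps of the last kind is `a`,
and the number of isolated or pendant edges is `b`. -/
inductive BuiltGraph {X : Type*} [DecidableEq X] : Finset X → Finset (Sym2 X) → ℕ → ℕ → Prop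
  | empty : BuiltGraph ∅ ∅ 0 0
  | vertex {Y E a b} (v : X) : BuiltGraph Y E a b → v ∉ Y → BuiltGraph (insert v Y) E a b
  | edge {Y E a b} (u v : X) : BuiltGraph Y E a b → u ∉ Y → v ∉ Y → u ≠ v →
      BuiltGraph (insert v (insert u Y)) (insert s(u, v) E) a (b + 1)
  | pendant {Y E a b} (u u' v : X) : BuiltGraph Y E a b → s(u, u') ∈ E → v ∉ Y →
      BuiltGraph (insert v Y) (insert s(u, v) E) a (b + 1)
  | triangle {Y E a b} (u u' v : X) : BuiltGraph Y E a b → s(u, u') ∈ E → u ≠ u' → v ∉ Y →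
      BuiltGraph (insert v Y) (insert s(u, v) (insert s(u', v) E)) (a + 1) b

namespace BuiltGraph

variable {X : Type*} [DecidableEq X] {Y : Finset X} {E : Finset (Sym2 X)} {a b : ℕ}

theorem mem_of_mem_edge (h : BuiltGraph Y E a b) {e : Sym2 X} (he : e ∈ E) {w : X} (hw : w ∈ e) :
    w ∈ Y := by
  induction h generalizing e w with
  | empty => simp at he
  | vertex v _ _ ih => exact Finset.mem_insert_of_mem (ih he hw)
  | edge u v _ _ _ _ ih =>
    rcases Finset.mem_insert.1 he with rfl | he
    · rcases Sym2.mem_iff.1 hw with h | h <;> simp [h]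
    · exact Finset.mem_insert_of_mem (Finset.mem_insert_of_mem (ih he hw))
  | pendant u u' v _ hE _ ih =>
    rcases Finset.mem_insert.1 he with rfl | he
    · rcases Sym2.mem_iff.1 hw with h | h <;> rw [h]
      · exact Finset.mem_insert_of_mem (ih hE (Sym2.mem_mk_left _ _))
      · simp
    · exact Finset.mem_insert_of_mem (ih he hw)
  | triangle u u' v _ hE _ _ ih =>
    rcases Finset.mem_insert.1 he with rfl | he
    · rcases Sym2.mem_iff.1 hw with h | h <;> rw [h]
      · exact Finset.mem_insert_of_mem (ih hE (Sym2.mem_mk_left _ _))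
      · simp
    rcases Finset.mem_insert.1 he with rfl | he
    · rcases Sym2.mem_iff.1 hw with h | h <;> rw [h]
      · exact Finset.mem_insert_of_mem (ih hE (Sym2.mem_mk_right _ _))
      · simp
    · exact Finset.mem_insert_of_mem (ih he hw)

theorem notMem_edge (h : BuiltGraph Y E a b) {v : X} (hv : v ∉ Y) (u : X) : s(u, v) ∉ E :=
  fun he => hv (h.mem_of_mem_edge he (Sym2.mem_mk_right _ _))

theorem notMem_insert_edge (h : BuiltGraph Y E a b) {u u' v : X} (huu : u ≠ u') (hv : v ∉ Y) :
    s(u, v) ∉ insert s(u', v) E := by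
  rw [Finset.mem_insert, not_or]
  refine ⟨fun he => ?_, h.notMem_edge hv u⟩
  rcases Sym2.eq_iff.1 he with ⟨h1, _⟩ | ⟨h1, h2⟩
  · exact huu h1
  · exact huu (h1.trans h2)

theorem card_edges (h : BuiltGraph Y E a b) : E.card = 2 * a + b := by
  induction h with
  | empty => rfl
  | vertex v _ _ ih => exact ih
  | edge u v h _ hv _ ih => rw [Finset.card_insert_of_notMem (h.notMem_edge hv u), ih]; ring
  | pendant u u' v h _ hv ih => rw [Finset.card_insert_of_notMem (h.notMem_edge hv u), ih]; ring
  | triangle u u' v h _ huu hv ih =>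
    rw [Finset.card_insert_of_notMem (h.notMem_insert_edge huu hv),
      Finset.card_insert_of_notMem (h.notMem_edge hv u'), ih]
    ring

end BuiltGraph

/-! ### Random copies of a built graph, one vertex at a time -/

section Extend

variable {X : Type*} [Fintype X] [DecidableEq X]

/-- A probability density `h` on the cube that depends on the coordinates in `Y` only. -/
structure IsDensityOn (Y : Finset X) (h : (X → unitInterval) → ℝ) : Prop where
  bddMeas : BddMeas h
  nonneg : ∀ x, 0 ≤ h x
  update : ∀ v ∉ Y, ∀ x y, h (Function.update x v y) = h x
  integral_eq_one : ∫ x, h x = 1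

/-- A conditional density `κ` for the coordinate `v`, given the coordinates in `Y`. -/
structure IsCondDensity (Y : Finset X) (v : X) (κ : (X → unitInterval) → ℝ) : Prop where
  bddMeas : BddMeas κ
  nonneg : ∀ x, 0 ≤ κ x
  update : ∀ w ∉ insert v Y, ∀ x y, κ (Function.update x w y) = κ x
  integral_eq_one : ∀ x, ∫ y, κ (Function.update x v y) = 1

variable {Y : Finset X} {v : X} {h κ f : (X → unitInterval) → ℝ}

theorem IsDensityOn.integral_mul (hh : IsDensityOn Y h) (hv : v ∉ Y) (hκ : IsCondDensity Y v κ)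
    (hf : BddMeas f) : ∫ x, h x * κ x * f x
      = ∫ x, h x * ∫ y, κ (Function.update x v y) * f (Function.update x v y) := by
  rw [integral_eq_integral_update v ((hh.bddMeas.mul hκ.bddMeas).mul hf)]
  congr 1 with x
  simp only [hh.update v hv, mul_assoc, integral_const_mul]

/-- A function that does not involve the new coordinate keeps its mean. -/
theorem IsDensityOn.integral_mul_of_update (hh : IsDensityOn Y h) (hv : v ∉ Y)
    (hκ : IsCondDensity Y v κ) (hf : BddMeas f) (hfv : ∀ x y, f (Function.update x v y) = f x) :
    ∫ x, h x * κ x * f x = ∫ x, h x * f x := by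
  rw [hh.integral_mul hv hκ hf]
  simp only [hfv, integral_mul_const, hκ.integral_eq_one, one_mul]

theorem IsDensityOn.mul (hh : IsDensityOn Y h) (hv : v ∉ Y) (hκ : IsCondDensity Y v κ) :
    IsDensityOn (insert v Y) fun x => h x * κ x where
  bddMeas := hh.bddMeas.mul hκ.bddMeas
  nonneg x := mul_nonneg (hh.nonneg x) (hκ.nonneg x)
  update w hw x y := by
    rw [hκ.update w hw, hh.update w fun h => hw (Finset.mem_insert_of_mem h)]
  integral_eq_one := by
    have := hh.integral_mul_of_update hv hκ (BddMeas.const 1) fun _ _ => rfl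
    simpa [hh.integral_eq_one] using this

end Extend

namespace Graphon

section CondDensity

variable {X : Type*} [DecidableEq X] {W : Graphon} {u u' v : X} {Y : Finset X} {ε : ℝ}

/-- The conditional density of the end `v` of a pendant edge at `u`. -/
theorem isCondDensity_pendant (hε : 0 < ε) (hW : ∀ x y, ε ≤ W.toFun x y) (hu : u ∈ Y)
    (hv : v ∉ Y) : IsCondDensity Y v fun x : X → unitInterval =>
      W.toFun (x u) (x v) * W.codegree (x u) (x v) * (W.triangleDegree (x u))⁻¹ where
  bddMeas := ((W.bddMeas_comp (by fun_prop) (by fun_prop)).mul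
    (W.bddMeas_codegree_comp (by fun_prop) (by fun_prop))).mul
    ((W.bddMeas_triangleDegree.comp (by fun_prop)).inv (pow_pos hε 3)
      fun _ => cube_le_triangleDegree hε.le hW _)
  nonneg x := mul_nonneg (mul_nonneg (W.nonneg' _ _) (W.codegree_nonneg _ _))
    (inv_nonneg.2 ((pow_pos hε 3).le.trans (cube_le_triangleDegree hε.le hW _)))
  update w hw x y := by
    rw [Finset.mem_insert, not_or] at hw
    rw [Function.update_of_ne (by rintro rfl; exact hw.2 hu), Function.update_of_ne (Ne.symm hw.1)]
  integral_eq_one x := by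
    have huv : u ≠ v := by rintro rfl; exact hv hu
    simp only [Function.update_self, Function.update_of_ne huv, integral_mul_const]
    exact mul_inv_cancel₀ ((pow_pos hε 3).trans_le (cube_le_triangleDegree hε.le hW _)).ne'

/-- The conditional density of the first vertex of an isolated edge. -/
theorem isCondDensity_root (hε : 0 < ε) (hW : ∀ x y, ε ≤ W.toFun x y) :
    IsCondDensity Y v fun x : X → unitInterval =>
      W.triangleDegree (x v) * W.triangleDensity⁻¹ where
  bddMeas := (W.bddMeas_triangleDegree.comp (by fun_prop)).mul (BddMeas.const _)
  nonneg x := mul_nonneg ((pow_pos hε 3).le.trans (cube_le_triangleDegree hε.le hW _))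
    (inv_nonneg.2 (triangleDensity_pos hε hW).le)
  update w hw x y := by
    rw [Finset.mem_insert, not_or] at hw
    rw [Function.update_of_ne (Ne.symm hw.1)]
  integral_eq_one x := by
    simp only [Function.update_self, integral_mul_const]
    exact mul_inv_cancel₀ (triangleDensity_pos hε hW).ne'

/-- The conditional density of a vertex `v` joined to both ends of the edge `u u'`. -/
theorem isCondDensity_triangle (hε : 0 < ε) (hW : ∀ x y, ε ≤ W.toFun x y) (hu : u ∈ Y)
    (hu' : u' ∈ Y) (hv : v ∉ Y) : IsCondDensity Y v fun x : X → unitInterval =>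
      W.toFun (x u) (x v) * W.toFun (x u') (x v) * (W.codegree (x u) (x u'))⁻¹ where
  bddMeas := ((W.bddMeas_comp (by fun_prop) (by fun_prop)).mul
    (W.bddMeas_comp (by fun_prop) (by fun_prop))).mul
    ((W.bddMeas_codegree_comp (by fun_prop) (by fun_prop)).inv (pow_pos hε 2)
      fun _ => sq_le_codegree hε.le hW _ _)
  nonneg x := mul_nonneg (mul_nonneg (W.nonneg' _ _) (W.nonneg' _ _))
    (inv_nonneg.2 (W.codegree_nonneg _ _))
  update w hw x y := by
    rw [Finset.mem_insert, not_or] at hw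
    rw [Function.update_of_ne (by rintro rfl; exact hw.2 hu), Function.update_of_ne (Ne.symm hw.1),
      Function.update_of_ne (by rintro rfl; exact hw.2 hu')]
  integral_eq_one x := by
    have huv : u ≠ v := by rintro rfl; exact hv hu
    have huv' : u' ≠ v := by rintro rfl; exact hv hu'
    simp only [Function.update_self, Function.update_of_ne huv, Function.update_of_ne huv',
      integral_mul_const]
    exact mul_inv_cancel₀ ((pow_pos hε 2).trans_le (sq_le_codegree hε.le hW _ _)).ne'

end CondDensity

theorem onPair_map_mk {X : Type*} (W : Graphon) (x : X → unitInterval) (u v : X) :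
    W.onPair (s(u, v).map x) = W.toFun (x u) (x v) := rfl

variable {X : Type*} [Fintype X] (W : Graphon)

/-- Under `h`, the edge `uv` is distributed like an edge of a random triangle of `W`. -/
def EdgeMarginal (h : (X → unitInterval) → ℝ) (u v : X) : Prop :=
  ∀ ψ : unitInterval → unitInterval → ℝ, BddMeas (Function.uncurry ψ) →
    ∫ x, h x * ψ (x u) (x v)
      = ∫ x, ∫ y, W.toFun x y * W.codegree x y / W.triangleDensity * ψ x y

/-- Under `h`, the vertex `u` is distributed like a vertex of a random triangle of `W`. -/
def VertexMarginal (h : (X → unitInterval) → ℝ) (u : X) : Prop :=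
  ∀ ψ : unitInterval → ℝ, BddMeas ψ →
    ∫ x, h x * ψ (x u) = ∫ x, W.triangleDegree x / W.triangleDensity * ψ x

theorem bddMeas_edgeWeight : BddMeas (Function.uncurry fun x y =>
    W.toFun x y * W.codegree x y / W.triangleDensity) := by
  simp only [div_eq_mul_inv]
  exact (W.bddMeas.mul W.bddMeas_codegree).mul (BddMeas.const _)

variable {W} {h κ g : (X → unitInterval) → ℝ} {u u' v : X} {Y : Finset X}

theorem EdgeMarginal.symm (hm : W.EdgeMarginal h u v) : W.EdgeMarginal h v u := by
  intro ψ hψ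
  rw [hm (fun x y => ψ y x) (hψ.comp measurable_swap),
    BddMeas.integral_swap (W.bddMeas_edgeWeight.mul (hψ.comp measurable_swap))]
  simp only [W.symm' _, W.codegree_comm _]

theorem EdgeMarginal.vertexMarginal (hm : W.EdgeMarginal h u v) : W.VertexMarginal h u := by
  intro ψ hψ
  rw [hm (fun x _ => ψ x) (hψ.comp measurable_fst)]
  congr 1 with x
  rw [integral_mul_const, integral_div]
  rfl

variable [DecidableEq X]

/-- Adding a vertex does not change the distribution of the older edges. -/
theorem EdgeMarginal.mul (hm : W.EdgeMarginal h u u') (hh : IsDensityOn Y h) (hv : v ∉ Y)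
    (hκ : IsCondDensity Y v κ) (hu : u ∈ Y) (hu' : u' ∈ Y) :
    W.EdgeMarginal (fun x => h x * κ x) u u' := by
  intro ψ hψ
  rw [← hm ψ hψ]
  refine hh.integral_mul_of_update hv hκ (f := fun x => ψ (x u) (x u'))
    (hψ.comp (φ := fun x : X → unitInterval => (x u, x u')) (by fun_prop)) fun x y => ?_
  rw [Function.update_of_ne (by rintro rfl; exact hv hu),
    Function.update_of_ne (by rintro rfl; exact hv hu')]

/-- The data of the entropy argument for a graph with vertex set `Y` and edge set `E`: a density
`h`, and the logarithm `g` of the quotient of the edge weights by `h`. -/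
structure EntropyData (W : Graphon) (Y : Finset X) (E : Finset (Sym2 X))
    (h g : (X → unitInterval) → ℝ) : Prop where
  density : IsDensityOn Y h
  bddMeas : BddMeas g
  update : ∀ v ∉ Y, ∀ x y, g (Function.update x v y) = g x
  weight : ∀ x, h x * Real.exp (g x) = ∏ e ∈ E, W.onPair (e.map x)
  marginal : ∀ u v, s(u, v) ∈ E → W.EdgeMarginal h u v

variable {E E' : Finset (Sym2 X)} {γ : (X → unitInterval) → ℝ}

/-- Adding a vertex `v`: the density is multiplied by a conditional density `κ`, and the product of
the new edge weights is `κ exp γ`. -/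
theorem EntropyData.extend (hd : EntropyData W Y E h g) (hv : v ∉ Y) (hκ : IsCondDensity Y v κ)
    (hY : ∀ e ∈ E, ∀ w ∈ e, w ∈ Y)
    (hγ : BddMeas γ) (hγY : ∀ w ∉ insert v Y, ∀ x y, γ (Function.update x w y) = γ x)
    (hE' : ∀ x, κ x * Real.exp (γ x) * ∏ e ∈ E, W.onPair (e.map x)
      = ∏ e ∈ E', W.onPair (e.map x))
    (hm : ∀ u w, s(u, w) ∈ E' → s(u, w) ∉ E → W.EdgeMarginal (fun x => h x * κ x) u w) :
    EntropyData W (insert v Y) E' (fun x => h x * κ x) (fun x => g x + γ x) ∧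
      ∫ x, h x * κ x * (g x + γ x) = (∫ x, h x * g x) + ∫ x, h x * κ x * γ x := by
  refine ⟨⟨hd.density.mul hv hκ, hd.bddMeas.add hγ, fun w hw x y => ?_, fun x => ?_,
    fun u w he => ?_⟩, ?_⟩
  · rw [hγY w hw, hd.update w fun h => hw (Finset.mem_insert_of_mem h)]
  · rw [← hE', ← hd.weight, Real.exp_add]
    ring
  · by_cases h' : s(u, w) ∈ E
    · exact (hd.marginal u w h').mul hd.density hv hκ (hY _ h' _ (Sym2.mem_mk_left _ _))
        (hY _ h' _ (Sym2.mem_mk_right _ _))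
    · exact hm u w he h'
  · have hb := hd.density.bddMeas.mul hκ.bddMeas
    simp only [mul_add]
    rw [integral_add ((hb.mul hd.bddMeas).integrable _) ((hb.mul hγ).integrable _),
      hd.density.integral_mul_of_update hv hκ hd.bddMeas (hd.update v hv)]

variable {ε : ℝ}

/-- The new pendant edge at `u` has the required distribution, because its end `u` has. -/
theorem edgeMarginal_pendant (hε : 0 < ε) (hW : ∀ x y, ε ≤ W.toFun x y) (hh : IsDensityOn Y h)
    (hu : u ∈ Y) (hv : v ∉ Y) (hm : W.VertexMarginal h u) :
    W.EdgeMarginal (fun x => h x * (W.toFun (x u) (x v) * W.codegree (x u) (x v)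
      * (W.triangleDegree (x u))⁻¹)) u v := by
  intro ψ hψ
  have huv : u ≠ v := by rintro rfl; exact hv hu
  rw [hh.integral_mul hv (isCondDensity_pendant hε hW hu hv) (f := fun x => ψ (x u) (x v))
    (hψ.comp (φ := fun x : X → unitInterval => (x u, x v)) (by fun_prop))]
  simp only [Function.update_self, Function.update_of_ne huv]
  have hF : BddMeas fun r => ∫ y, W.toFun r y * W.codegree r y * (W.triangleDegree r)⁻¹ * ψ r y :=
    BddMeas.integral_right (f := fun p : unitInterval × unitInterval => W.toFun p.1 p.2
      * W.codegree p.1 p.2 * (W.triangleDegree p.1)⁻¹ * ψ p.1 p.2)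
      (((W.bddMeas.mul W.bddMeas_codegree).mul
        ((W.bddMeas_triangleDegree.comp measurable_fst).inv (pow_pos hε 3)
          fun _ => cube_le_triangleDegree hε.le hW _)).mul hψ) volume
  rw [hm _ hF]
  congr 1 with r
  rw [← integral_const_mul]
  congr 1 with y
  have := ((pow_pos hε 3).trans_le (cube_le_triangleDegree hε.le hW r)).ne'
  field_simp

theorem vertexMarginal_root (hε : 0 < ε) (hW : ∀ x y, ε ≤ W.toFun x y) (hh : IsDensityOn Y h)
    (hv : v ∉ Y) :
    W.VertexMarginal (fun x => h x * (W.triangleDegree (x v) * W.triangleDensity⁻¹)) v := by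
  intro ψ hψ
  rw [hh.integral_mul hv (isCondDensity_root hε hW) (f := fun x => ψ (x v))
    (hψ.comp (φ := fun x : X → unitInterval => x v) (by fun_prop))]
  simp only [Function.update_self, integral_mul_const, hh.integral_eq_one, one_mul, div_eq_mul_inv]

/-- If the edge `u u'` is distributed like an edge of a random triangle, then `v` completes it to a
random triangle, so that the edge `u v` has the same distribution. -/
theorem edgeMarginal_triangle (hε : 0 < ε) (hW : ∀ x y, ε ≤ W.toFun x y) (hh : IsDensityOn Y h)
    (hu : u ∈ Y) (hu' : u' ∈ Y) (hv : v ∉ Y) (hm : W.EdgeMarginal h u u') :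
    W.EdgeMarginal (fun x => h x * (W.toFun (x u) (x v) * W.toFun (x u') (x v)
      * (W.codegree (x u) (x u'))⁻¹)) u v := by
  intro ψ hψ
  have huv : u ≠ v := by rintro rfl; exact hv hu
  have huv' : u' ≠ v := by rintro rfl; exact hv hu'
  rw [hh.integral_mul hv (isCondDensity_triangle hε hW hu hu' hv) (f := fun x => ψ (x u) (x v))
    (hψ.comp (φ := fun x : X → unitInterval => (x u, x v)) (by fun_prop))]
  simp only [Function.update_self, Function.update_of_ne huv, Function.update_of_ne huv']
  have hF : BddMeas (Function.uncurry fun r s =>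
      ∫ y, W.toFun r y * W.toFun s y * (W.codegree r s)⁻¹ * ψ r y) :=
    BddMeas.integral_right (f := fun p : (unitInterval × unitInterval) × unitInterval =>
      W.toFun p.1.1 p.2 * W.toFun p.1.2 p.2 * (W.codegree p.1.1 p.1.2)⁻¹ * ψ p.1.1 p.2)
      ((((W.bddMeas_comp (by fun_prop) (by fun_prop)).mul
        (W.bddMeas_comp (by fun_prop) (by fun_prop))).mul
        ((W.bddMeas_codegree_comp (by fun_prop) (by fun_prop)).inv (pow_pos hε 2)
          fun _ => sq_le_codegree hε.le hW _ _)).mul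
        (hψ.comp (φ := fun p : (unitInterval × unitInterval) × unitInterval => (p.1.1, p.2))
          (by fun_prop))) volume
  rw [hm _ hF]
  congr 1 with r
  calc ∫ s, W.toFun r s * W.codegree r s / W.triangleDensity
        * ∫ y, W.toFun r y * W.toFun s y * (W.codegree r s)⁻¹ * ψ r y
      = ∫ s, ∫ y, (W.toFun r y / W.triangleDensity * ψ r y) * (W.toFun r s * W.toFun y s) := by
        congr 1 with s
        rw [← integral_const_mul]
        congr 1 with y
        have := ((pow_pos hε 2).trans_le (sq_le_codegree hε.le hW r s)).ne'
        rw [W.symm' y s]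
        field_simp
    _ = ∫ y, ∫ s, (W.toFun r y / W.triangleDensity * ψ r y) * (W.toFun r s * W.toFun y s) := by
        refine BddMeas.integral_swap ?_ _ _
        simp only [div_eq_mul_inv]
        exact (((W.bddMeas_comp measurable_const measurable_snd).mul (BddMeas.const _)).mul
          (hψ.comp (φ := fun p : unitInterval × unitInterval => (r, p.2)) (by fun_prop))).mul
          ((W.bddMeas_comp measurable_const measurable_fst).mul
            (W.bddMeas_comp measurable_snd measurable_fst))
    _ = _ := by
        congr 1 with y
        rw [integral_const_mul]
        simp only [codegree]
        ring

end Graphon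

/-! ### The entropy bound for the density of a built graph -/

namespace Graphon

variable {X : Type*} [Fintype X] [DecidableEq X] {W : Graphon} {ε : ℝ} {Y : Finset X}
  {E : Finset (Sym2 X)} {a b : ℕ}

/-- A pendant edge: `v` has the conditional density `W c / d` given `u`, where `c` is the codegree
and `d` the triangle degree, so that the new edge weight is `exp (log d - log c)` times it. -/
theorem EntropyData.extend_pendant {h g : (X → unitInterval) → ℝ} {u v : X}
    (hε : 0 < ε) (hW : ∀ x y, ε ≤ W.toFun x y) (hd : EntropyData W Y E h g)
    (hE : ∀ e ∈ E, ∀ w ∈ e, w ∈ Y) (hu : u ∈ Y) (hv : v ∉ Y) (hm : W.VertexMarginal h u) :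
    ∃ h' g', EntropyData W (insert v Y) (insert s(u, v) E) h' g' ∧
      ∫ x, h' x * g' x = (∫ x, h x * g x)
        + ((∫ x, W.triangleDegree x / W.triangleDensity * Real.log (W.triangleDegree x))
          - W.meanLogCodegree) := by
  have hκ := isCondDensity_pendant (W := W) hε hW hu hv
  have hem := edgeMarginal_pendant hε hW hd.density hu hv hm
  have hTpos : ∀ x, 0 < W.triangleDegree x := fun x =>
    (pow_pos hε 3).trans_le (cube_le_triangleDegree hε.le hW _)
  have hcpos : ∀ x y, 0 < W.codegree x y := fun x y =>
    (pow_pos hε 2).trans_le (sq_le_codegree hε.le hW _ _)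
  have hψ : BddMeas (Function.uncurry fun r s =>
      Real.log (W.triangleDegree r) - Real.log (W.codegree r s)) :=
    ((W.bddMeas_triangleDegree.log (pow_pos hε 3) (cube_le_triangleDegree hε.le hW)).comp
      measurable_fst).sub
      (W.bddMeas_codegree.log (pow_pos hε 2) fun p => sq_le_codegree hε.le hW p.1 p.2)
  have hvE : s(u, v) ∉ E := fun h => hv (hE _ h _ (Sym2.mem_mk_right _ _))
  obtain ⟨h1, h2⟩ := hd.extend (E' := insert s(u, v) E)
    (γ := fun x => Real.log (W.triangleDegree (x u)) - Real.log (W.codegree (x u) (x v)))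
    hv hκ hE (hψ.comp (φ := fun x : X → unitInterval => (x u, x v)) (by fun_prop))
    (fun w hw x y => by
      rw [Finset.mem_insert, not_or] at hw
      rw [Function.update_of_ne (by rintro rfl; exact hw.2 hu),
        Function.update_of_ne (Ne.symm hw.1)])
    (fun x => by
      rw [Finset.prod_insert hvE, onPair_map_mk, Real.exp_sub, Real.exp_log (hTpos _),
        Real.exp_log (hcpos _ _)]
      congr 1
      have := (hTpos (x u)).ne'
      have := (hcpos (x u) (x v)).ne'
      field_simp)
    (fun u₁ w he hne => by
      have := (Finset.mem_insert.1 he).resolve_right hne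
      rcases Sym2.eq_iff.1 this with ⟨rfl, rfl⟩ | ⟨rfl, rfl⟩
      exacts [hem, hem.symm])
  refine ⟨_, _, h1, h2.trans ?_⟩
  congr 1
  rw [hem _ hψ]
  have hlogT := W.bddMeas_triangleDegree.log (pow_pos hε 3) (cube_le_triangleDegree hε.le hW)
  have hlogc : BddMeas (Function.uncurry fun r s => Real.log (W.codegree r s)) :=
    W.bddMeas_codegree.log (pow_pos hε 2) fun p => sq_le_codegree hε.le hW p.1 p.2
  have b1 : BddMeas (Function.uncurry fun r s => W.toFun r s * W.codegree r s / W.triangleDensity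
      * Real.log (W.triangleDegree r)) := W.bddMeas_edgeWeight.mul (hlogT.comp measurable_fst)
  have b2 : BddMeas (Function.uncurry fun r s => W.toFun r s * W.codegree r s / W.triangleDensity
      * Real.log (W.codegree r s)) := W.bddMeas_edgeWeight.mul hlogc
  simp only [mul_sub]
  rw [BddMeas.integral2_sub b1 b2]
  congr 1
  congr 1 with r
  rw [integral_mul_const, integral_div]
  rfl

/-- The first vertex of an isolated edge. Its density is `d / t`, where `d` is the triangle degree
and `t` the triangle density, and it carries no edge weight. -/
theorem EntropyData.extend_root {h g : (X → unitInterval) → ℝ} {v : X}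
    (hε : 0 < ε) (hW : ∀ x y, ε ≤ W.toFun x y) (hd : EntropyData W Y E h g)
    (hE : ∀ e ∈ E, ∀ w ∈ e, w ∈ Y) (hv : v ∉ Y) :
    ∃ h' g', EntropyData W (insert v Y) E h' g' ∧ W.VertexMarginal h' v ∧
      ∫ x, h' x * g' x = (∫ x, h x * g x) + (Real.log W.triangleDensity
        - ∫ x, W.triangleDegree x / W.triangleDensity * Real.log (W.triangleDegree x)) := by
  have hκ := isCondDensity_root (W := W) (Y := Y) (v := v) hε hW
  have hvm := vertexMarginal_root hε hW hd.density hv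
  have ht := triangleDensity_pos hε hW
  have hTpos : ∀ x, 0 < W.triangleDegree x := fun x =>
    (pow_pos hε 3).trans_le (cube_le_triangleDegree hε.le hW _)
  have hlogT := W.bddMeas_triangleDegree.log (pow_pos hε 3) (cube_le_triangleDegree hε.le hW)
  have hψ := (BddMeas.const (Real.log W.triangleDensity)).sub hlogT
  obtain ⟨h1, h2⟩ := hd.extend (E' := E)
    (γ := fun x => Real.log W.triangleDensity - Real.log (W.triangleDegree (x v)))
    hv hκ hE (hψ.comp (φ := fun x : X → unitInterval => x v) (by fun_prop))
    (fun w hw x y => by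
      rw [Finset.mem_insert, not_or] at hw
      rw [Function.update_of_ne (Ne.symm hw.1)])
    (fun x => by
      rw [Real.exp_sub, Real.exp_log ht, Real.exp_log (hTpos _)]
      have := (hTpos (x v)).ne'
      field_simp)
    (fun u w he hne => absurd he hne)
  refine ⟨_, _, h1, hvm, h2.trans ?_⟩
  congr 1
  rw [hvm _ hψ]
  have b0 : BddMeas fun x => W.triangleDegree x / W.triangleDensity := by
    simp only [div_eq_mul_inv]
    exact W.bddMeas_triangleDegree.mul (BddMeas.const _)
  simp only [mul_sub]
  rw [integral_sub ((b0.mul (BddMeas.const _)).integrable _) ((b0.mul hlogT).integrable _),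
    integral_mul_const, integral_div, integral_triangleDegree, div_self ht.ne', one_mul]

/-- A vertex adjacent to both ends of `u u'`. Its conditional density is the product of the new edge
weights divided by the codegree of `u` and `u'`. -/
theorem EntropyData.extend_triangle {h g : (X → unitInterval) → ℝ} {u u' v : X}
    (hε : 0 < ε) (hW : ∀ x y, ε ≤ W.toFun x y) (hd : EntropyData W Y E h g)
    (hE : ∀ e ∈ E, ∀ w ∈ e, w ∈ Y) (huE : s(u, u') ∈ E) (huu : u ≠ u') (hv : v ∉ Y) :
    ∃ h' g', EntropyData W (insert v Y) (insert s(u, v) (insert s(u', v) E)) h' g' ∧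
      ∫ x, h' x * g' x = (∫ x, h x * g x) + W.meanLogCodegree := by
  have hu : u ∈ Y := hE _ huE _ (Sym2.mem_mk_left _ _)
  have hu' : u' ∈ Y := hE _ huE _ (Sym2.mem_mk_right _ _)
  have hm := hd.marginal u u' huE
  have hκ := isCondDensity_triangle (W := W) hε hW hu hu' hv
  have hem := edgeMarginal_triangle hε hW hd.density hu hu' hv hm
  have hem' : W.EdgeMarginal (fun x => h x * (W.toFun (x u) (x v) * W.toFun (x u') (x v)
      * (W.codegree (x u) (x u'))⁻¹)) u' v := by
    have := edgeMarginal_triangle hε hW hd.density hu' hu hv hm.symm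
    convert this using 4 with x
    · ring
    · rw [W.codegree_comm]
  have hcpos : ∀ x y, 0 < W.codegree x y := fun x y =>
    (pow_pos hε 2).trans_le (sq_le_codegree hε.le hW _ _)
  have hψ : BddMeas (Function.uncurry fun r s => Real.log (W.codegree r s)) :=
    W.bddMeas_codegree.log (pow_pos hε 2) fun p => sq_le_codegree hε.le hW p.1 p.2
  have hvE : ∀ w, s(w, v) ∉ E := fun w h => hv (hE _ h _ (Sym2.mem_mk_right _ _))
  have hne : s(u, v) ∉ insert s(u', v) E := by
    rw [Finset.mem_insert, not_or]
    refine ⟨fun he => ?_, hvE u⟩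
    rcases Sym2.eq_iff.1 he with ⟨h1, _⟩ | ⟨h1, h2⟩
    · exact huu h1
    · exact huu (h1.trans h2)
  obtain ⟨h1, h2⟩ := hd.extend (E' := insert s(u, v) (insert s(u', v) E))
    (γ := fun x => Real.log (W.codegree (x u) (x u')))
    hv hκ hE (hψ.comp (φ := fun x : X → unitInterval => (x u, x u')) (by fun_prop))
    (fun w hw x y => by
      rw [Finset.mem_insert, not_or] at hw
      rw [Function.update_of_ne (by rintro rfl; exact hw.2 hu),
        Function.update_of_ne (by rintro rfl; exact hw.2 hu')])
    (fun x => by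
      rw [Finset.prod_insert hne, Finset.prod_insert (hvE _), onPair_map_mk, onPair_map_mk,
        Real.exp_log (hcpos _ _), ← mul_assoc]
      congr 1
      have := (hcpos (x u) (x u')).ne'
      field_simp)
    (fun u₁ w he hne => by
      rcases Finset.mem_insert.1 he with he | he
      · rcases Sym2.eq_iff.1 he with ⟨rfl, rfl⟩ | ⟨rfl, rfl⟩
        exacts [hem, hem.symm]
      · rcases Sym2.eq_iff.1 ((Finset.mem_insert.1 he).resolve_right hne) with
          ⟨rfl, rfl⟩ | ⟨rfl, rfl⟩
        exacts [hem', hem'.symm])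
  refine ⟨_, _, h1, h2.trans ?_⟩
  congr 1
  exact (hm.mul hd.density hv hκ hu hu') _ hψ

/-- An isolated vertex is drawn uniformly. -/
theorem EntropyData.extend_isolated {h g : (X → unitInterval) → ℝ} {v : X}
    (hd : EntropyData W Y E h g) (hE : ∀ e ∈ E, ∀ w ∈ e, w ∈ Y) (hv : v ∉ Y) :
    ∃ h' g', EntropyData W (insert v Y) E h' g' ∧
      ∫ x, h' x * g' x = ∫ x, h x * g x := by
  obtain ⟨h1, h2⟩ := hd.extend (E' := E) (κ := fun _ => 1) (γ := fun _ => 0) hv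
    ⟨BddMeas.const 1, fun _ => zero_le_one, fun _ _ _ _ => rfl, fun _ => by simp⟩ hE
    (BddMeas.const 0) (fun _ _ _ _ => rfl) (fun x => by simp) (fun u w he hne => absurd he hne)
  exact ⟨_, _, h1, h2.trans (by simp)⟩

/-- The chain rule, with `a` vertices that close a triangle and `b` isolated or pendant edges: each
of the former contributes the mean of `log c`, where `c` is the codegree, and each of the latter at
least `log t(K₃, W)` minus this mean. -/
theorem exists_entropyData (hε : 0 < ε) (hW : ∀ x y, ε ≤ W.toFun x y) (hB : BuiltGraph Y E a b) :
    ∃ h g, EntropyData W Y E h g ∧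
      a * W.meanLogCodegree + b * (Real.log W.triangleDensity - W.meanLogCodegree)
        ≤ ∫ x, h x * g x := by
  have hτ := log_triangleDensity_le hε hW
  induction hB with
  | empty =>
    refine ⟨fun _ => 1, fun _ => 0, ⟨⟨BddMeas.const 1, fun _ => zero_le_one,
      fun _ _ _ _ => rfl, ?_⟩,
      BddMeas.const 0, fun _ _ _ _ => rfl, fun _ => by simp, fun u v h => by simp at h⟩, by simp⟩
    simp
  | vertex v hB hv ih =>
    obtain ⟨h, g, hd, hle⟩ := ih
    obtain ⟨h', g', hd', he⟩ := hd.extend_isolated (fun e he w hw => hB.mem_of_mem_edge he hw) hv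
    exact ⟨h', g', hd', hle.trans_eq he.symm⟩
  | edge u v hB hu hv huv ih =>
    obtain ⟨h, g, hd, hle⟩ := ih
    have hE := fun e he w hw => hB.mem_of_mem_edge (e := e) he (w := w) hw
    obtain ⟨h', g', hd', hm, he⟩ := hd.extend_root hε hW hE hu
    obtain ⟨h'', g'', hd'', he'⟩ := hd'.extend_pendant hε hW (v := v)
      (fun e he w hw => Finset.mem_insert_of_mem (hE e he w hw)) (Finset.mem_insert_self _ _)
      (by simp [hv, huv.symm]) hm
    refine ⟨h'', g'', hd'', ?_⟩
    rw [he', he]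
    push_cast
    linarith
  | pendant u u' v hB hE hv ih =>
    obtain ⟨h, g, hd, hle⟩ := ih
    obtain ⟨h', g', hd', he⟩ := hd.extend_pendant hε hW
      (fun e he w hw => hB.mem_of_mem_edge he hw) (hB.mem_of_mem_edge hE (Sym2.mem_mk_left _ _)) hv
      (hd.marginal u u' hE).vertexMarginal
    refine ⟨h', g', hd', ?_⟩
    rw [he]
    push_cast
    linarith
  | triangle u u' v hB hE huu hv ih =>
    obtain ⟨h, g, hd, hle⟩ := ih
    obtain ⟨h', g', hd', he⟩ := hd.extend_triangle hε hW
      (fun e he w hw => hB.mem_of_mem_edge he hw) hE huu hv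
    refine ⟨h', g', hd', ?_⟩
    rw [he]
    push_cast
    linarith

/-- Jensen's inequality for the exponential function and the density `h`. -/
theorem exp_integral_le {h g : (X → unitInterval) → ℝ} (hd : EntropyData W Y E h g) :
    Real.exp (∫ x, h x * g x) ≤ ∫ x : X → unitInterval, ∏ e ∈ E, W.onPair (e.map x) := by
  set m := ∫ x, h x * g x with hm
  have hh := hd.density.bddMeas
  have hg := hd.bddMeas
  have hexp : ∀ x, h x * Real.exp (g x) = ∏ e ∈ E, W.onPair (e.map x) := hd.weight
  have hprod : BddMeas fun x : X → unitInterval => ∏ e ∈ E, W.onPair (e.map x) := by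
    refine BddMeas.finset_prod _ fun e _ => ?_
    induction e with
    | _ u v => exact W.bddMeas_comp (by fun_prop) (by fun_prop)
  have hb := (hh.const_mul (1 - m)).add (hh.mul hg)
  -- The exponential function lies above its tangent at the mean `m`.
  have h1 : ∫ x, Real.exp m * ((1 - m) * h x + h x * g x)
      ≤ ∫ x : X → unitInterval, ∏ e ∈ E, W.onPair (e.map x) := by
    refine integral_mono ((hb.const_mul _).integrable _) (hprod.integrable _) fun x => ?_
    dsimp only
    rw [← hexp]
    have h2 := Real.add_one_le_exp (g x - m)
    have h3 : Real.exp (g x) = Real.exp m * Real.exp (g x - m) := by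
      rw [← Real.exp_add]
      congr 1
      ring
    rw [h3]
    have h4 := mul_le_mul_of_nonneg_left h2
      (mul_nonneg (hd.density.nonneg x) (Real.exp_pos m).le)
    linarith
  rw [integral_const_mul, integral_add ((hh.const_mul _).integrable _) ((hh.mul hg).integrable _),
    integral_const_mul, hd.density.integral_eq_one, ← hm] at h1
  linarith

theorem triangleDensity_pow_le_of_pos (hε : 0 < ε) (hW : ∀ x y, ε ≤ W.toFun x y)
    (hB : BuiltGraph Y E a b) (hba : b ≤ a) :
    W.triangleDensity ^ a
      ≤ (∫ x : X → unitInterval, ∏ e ∈ E, W.onPair (e.map x)) * W.edgeDensity ^ (a - b) := by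
  have ht := triangleDensity_pos hε hW
  have hp := edgeDensity_pos hε hW
  obtain ⟨h, g, hd, hle⟩ := exists_entropyData hε hW hB
  have hC := log_sub_log_le_meanLogCodegree hε hW
  have h1 := exp_integral_le hd
  have hab : (0 : ℝ) ≤ (a : ℝ) - b := sub_nonneg.2 (by exact_mod_cast hba)
  have h2 : a * Real.log W.triangleDensity - (a - b : ℕ) * Real.log W.edgeDensity
      ≤ ∫ x, h x * g x := by
    refine le_trans ?_ hle
    rw [Nat.cast_sub hba]
    nlinarith [mul_le_mul_of_nonneg_left hC hab]
  have h3 := (Real.exp_le_exp.2 h2).trans h1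
  rw [Real.exp_sub, div_le_iff₀ (Real.exp_pos _), ← Real.log_pow, ← Real.log_pow,
    Real.exp_log (pow_pos ht _), Real.exp_log (pow_pos hp _)] at h3
  exact h3

/-- The mixture of `W` with the constant graphon `1`, which is bounded away from zero. -/
noncomputable def mixOne (W : Graphon) (ε : unitInterval) : Graphon where
  toFun x y := (1 - ε) * W.toFun x y + ε
  measurable' := (W.measurable'.const_mul _).add_const _
  symm' x y := by rw [W.symm']
  nonneg' x y := add_nonneg (mul_nonneg (sub_nonneg.2 ε.2.2) (W.nonneg' _ _)) ε.2.1
  le_one' x y := by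
    have := mul_le_mul_of_nonneg_left (W.le_one' x y) (sub_nonneg.2 ε.2.2)
    linarith

theorem le_mixOne (W : Graphon) (ε : unitInterval) (x y : unitInterval) :
    (ε : ℝ) ≤ (W.mixOne ε).toFun x y :=
  le_add_of_nonneg_left (mul_nonneg (sub_nonneg.2 ε.2.2) (W.nonneg' _ _))

open Filter Topology in
theorem tendsto_integral_prod_mixOne {X : Type*} [Fintype X] (W : Graphon) (E : Finset (Sym2 X))
    {ε : ℕ → unitInterval} (hε : Tendsto (fun n => (ε n : ℝ)) atTop (𝓝 0)) :
    Tendsto (fun n => ∫ x : X → unitInterval, ∏ e ∈ E, (W.mixOne (ε n)).onPair (e.map x)) atTop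
      (𝓝 (∫ x : X → unitInterval, ∏ e ∈ E, W.onPair (e.map x))) := by
  have hprod : ∀ W : Graphon, BddMeas fun x : X → unitInterval =>
      ∏ e ∈ E, W.onPair (e.map x) := by
    intro W
    refine BddMeas.finset_prod _ fun e _ => ?_
    induction e with
    | _ u v => exact W.bddMeas_comp (by fun_prop) (by fun_prop)
  refine tendsto_integral_of_dominated_convergence (fun _ => 1)
    (fun n => (hprod _).measurable.aestronglyMeasurable) (integrable_const _)
    (fun n => Eventually.of_forall fun x => ?_) (Eventually.of_forall fun x => ?_)
  · rw [Real.norm_eq_abs, abs_of_nonneg (Finset.prod_nonneg fun e _ => onPair_nonneg _ _)]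
    exact Finset.prod_le_one (fun e _ => onPair_nonneg _ _) fun e _ => onPair_le_one _ _
  · refine tendsto_finsetProd _ fun e _ => ?_
    induction e with
    | _ u v =>
    have : Tendsto (fun n => (1 - (ε n : ℝ)) * W.toFun (x u) (x v) + ε n) atTop
        (𝓝 ((1 - 0) * W.toFun (x u) (x v) + 0)) :=
      ((tendsto_const_nhds.sub hε).mul_const _).add hε
    rw [sub_zero, one_mul, add_zero] at this
    exact this

theorem edgeDensity_eq_integral_prod (W : Graphon) :
    W.edgeDensity = ∫ x : Fin 2 → unitInterval, ∏ e ∈ {s(0, 1)}, W.onPair (e.map x) := by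
  simp only [Finset.prod_singleton, onPair_map_mk]
  exact (integral_eval_pair (by decide) W.bddMeas).symm

theorem triangleDensity_eq_integral_prod (W : Graphon) :
    W.triangleDensity = ∫ x : Fin 3 → unitInterval,
      ∏ e ∈ {s(0, 1), s(0, 2), s(1, 2)}, W.onPair (e.map x) := by
  rw [triangleDensity_eq]
  have : ∀ x : Fin 3 → unitInterval, ∏ e ∈ {s(0, 1), s(0, 2), s(1, 2)}, W.onPair (e.map x)
      = W.toFun (x 0) (x 1) * (W.toFun (x 0) (x 2) * W.toFun (x 1) (x 2)) := by
    intro x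
    rw [Finset.prod_insert (by decide), Finset.prod_insert (by decide), Finset.prod_singleton]
    rfl
  simp only [this]
  exact (integral_eval_triple (g := fun u v w => W.toFun u v * (W.toFun u w * W.toFun v w))
    (by decide) (by decide) (by decide) ((W.bddMeas_comp (by fun_prop) (by fun_prop)).mul
      ((W.bddMeas_comp (by fun_prop) (by fun_prop)).mul
        (W.bddMeas_comp (by fun_prop) (by fun_prop))))).symm

open Filter Topology in
/-- The lower bound on the density of a built graph by the densities of a triangle and an edge. -/
theorem triangleDensity_pow_le (W : Graphon) (hB : BuiltGraph Y E a b) (hba : b ≤ a) :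
    W.triangleDensity ^ a
      ≤ (∫ x : X → unitInterval, ∏ e ∈ E, W.onPair (e.map x)) * W.edgeDensity ^ (a - b) := by
  let ε : ℕ → unitInterval := fun n =>
    ⟨1 / ((n : ℝ) + 1), Nat.one_div_pos_of_nat.le, by
      rw [div_le_one (by positivity)]
      linarith [(Nat.cast_nonneg n : (0 : ℝ) ≤ n)]⟩
  have hε : Tendsto (fun n => (ε n : ℝ)) atTop (𝓝 0) := tendsto_one_div_add_atTop_nhds_zero_nat
  have h3 := W.tendsto_integral_prod_mixOne (X := Fin 3) {s(0, 1), s(0, 2), s(1, 2)} hε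
  have h2 := W.tendsto_integral_prod_mixOne (X := Fin 2) {s(0, 1)} hε
  simp only [← edgeDensity_eq_integral_prod, ← triangleDensity_eq_integral_prod] at h2 h3
  refine le_of_tendsto_of_tendsto' (h3.pow a)
    ((W.tendsto_integral_prod_mixOne E hε).mul (h2.pow (a - b))) fun n => ?_
  exact triangleDensity_pow_le_of_pos (ε := ε n) Nat.one_div_pos_of_nat (W.le_mixOne _) hB hba

end Graphon

/-! ### The graph of a tree of subsets of a triangle is a built graph -/

section Attach

variable {X : Type*} [DecidableEq X]

theorem image_offDiag_pair (c : Fin 3 → X) {p q : Fin 3} (hpq : p ≠ q) :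
    (({p, q} : Finset (Fin 3)).offDiag.image fun x => s(c x.1, c x.2)) = {s(c p, c q)} := by
  ext e
  simp only [Finset.mem_image, Finset.mem_offDiag, Prod.exists, Finset.mem_insert,
    Finset.mem_singleton]
  constructor
  · rintro ⟨x, y, ⟨rfl | rfl, rfl | rfl, hxy⟩, rfl⟩
    exacts [absurd rfl hxy, rfl, Sym2.eq_swap, absurd rfl hxy]
  · rintro rfl
    exact ⟨p, q, ⟨Or.inl rfl, Or.inr rfl, hpq⟩, rfl⟩

theorem image_offDiag_triple (c : Fin 3 → X) {p q r : Fin 3} (hpq : p ≠ q) (hpr : p ≠ r)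
    (hqr : q ≠ r) : (({p, q, r} : Finset (Fin 3)).offDiag.image fun x => s(c x.1, c x.2))
      = {s(c p, c r), s(c q, c r), s(c p, c q)} := by
  ext e
  simp only [Finset.mem_image, Finset.mem_offDiag, Prod.exists, Finset.mem_insert,
    Finset.mem_singleton]
  constructor
  · rintro ⟨x, y, ⟨rfl | rfl | rfl, rfl | rfl | rfl, hxy⟩, rfl⟩
    all_goals first
      | exact absurd rfl hxy
      | exact Or.inl rfl
      | exact Or.inl Sym2.eq_swap
      | exact Or.inr (Or.inl rfl)
      | exact Or.inr (Or.inl Sym2.eq_swap)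
      | exact Or.inr (Or.inr rfl)
      | exact Or.inr (Or.inr Sym2.eq_swap)
  · rintro (rfl | rfl | rfl)
    · exact ⟨p, r, ⟨Or.inl rfl, Or.inr (Or.inr rfl), hpr⟩, rfl⟩
    · exact ⟨q, r, ⟨Or.inr (Or.inl rfl), Or.inr (Or.inr rfl), hqr⟩, rfl⟩
    · exact ⟨p, q, ⟨Or.inl rfl, Or.inr (Or.inl rfl), hpq⟩, rfl⟩

/-- Attaching a copy `c` of the complete graph on `B ⊆ Fin 3` to a built graph along the copy of
`A ⊂ B`. The vertices of this copy have to be non-isolated, since a pendant edge is attached at an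
end of an older edge. -/
theorem BuiltGraph.attach {Y : Finset X} {E : Finset (Sym2 X)}
    {a b : ℕ} (h : BuiltGraph Y E a b) {A B : Finset (Fin 3)} (hAB : A ⊂ B) (c : Fin 3 → X)
    (hc : Set.InjOn c B) (hA : ∀ w ∈ A, c w ∈ Y) (hB : ∀ w ∈ B, w ∉ A → c w ∉ Y)
    (hA1 : ∀ w ∈ A, ∃ u, s(c w, u) ∈ E) (hA2 : ∀ w ∈ A, ∀ w' ∈ A, w ≠ w' → s(c w, c w') ∈ E) :
    ∃ b', BuiltGraph (Y ∪ B.image c) (E ∪ B.offDiag.image fun p => s(c p.1, c p.2))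
        (a + if B.card = 3 then 1 else 0) b' ∧
      b' + (if A.card = 2 then 1 else 0)
        = b + (if B.card = 3 then 1 else 0) + if B.card = 2 then 1 else 0 := by
  have hB3 : B.card ≤ 3 := (Finset.card_le_univ B).trans_eq (by simp)
  have hlt := Finset.card_lt_card hAB
  have hsd : (B \ A).card = B.card - A.card := Finset.card_sdiff_of_subset hAB.1
  have hun : A ∪ (B \ A) = B := Finset.union_sdiff_of_subset hAB.1
  have hsdA : ∀ w ∈ B \ A, w ∈ B ∧ w ∉ A := fun w hw => Finset.mem_sdiff.1 hw
  have hne : ∀ {p q}, p ∈ B → q ∈ B → p ≠ q → c p ≠ c q := fun hp hq hpq h => hpq (hc hp hq h)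
  have hA0 : A.card = 0 ∨ A.card = 1 ∨ A.card = 2 := by omega
  rcases hA0 with h0 | h1 | h2
  · have hA' := Finset.card_eq_zero.1 h0
    subst hA'
    have hBc : B.card = 1 ∨ B.card = 2 ∨ B.card = 3 := by omega
    rcases hBc with k | k | k
    · obtain ⟨p, rfl⟩ := Finset.card_eq_one.1 k
      refine ⟨b, ?_, by simp⟩
      have h' := h.vertex (c p) (hB p (by simp) (by simp))
      have e1 : Y ∪ Finset.image c {p} = insert (c p) Y := by
        rw [Finset.image_singleton, Finset.union_comm]
        rfl
      simpa [e1] using h'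
    · obtain ⟨p, q, hpq, rfl⟩ := Finset.card_eq_two.1 k
      refine ⟨b + 1, ?_, by simp [k]⟩
      have h' := h.edge (c p) (c q) (hB p (by simp) (by simp)) (hB q (by simp) (by simp))
        (hne (by simp) (by simp) hpq)
      have e1 : Y ∪ Finset.image c {p, q} = insert (c q) (insert (c p) Y) := by
        rw [Finset.image_insert, Finset.image_singleton]
        clear * -
        grind
      rw [image_offDiag_pair c hpq, e1, Finset.union_comm, if_neg (by omega)]
      exact h'
    · obtain ⟨p, q, r, hpq, hpr, hqr, rfl⟩ := Finset.card_eq_three.1 k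
      refine ⟨b + 1, ?_, by simp [k]⟩
      have k1 := hne (p := r) (q := p) (by simp) (by simp) hpr.symm
      have k2 := hne (p := r) (q := q) (by simp) (by simp) hqr.symm
      have k3 := hB r (by simp) (by simp)
      have h' := (h.edge (c p) (c q) (hB p (by simp) (by simp)) (hB q (by simp) (by simp))
        (hne (by simp) (by simp) hpq)).triangle (c p) (c q) (c r) (by simp)
        (hne (by simp) (by simp) hpq) (by simp [k1, k2, k3])
      have e1 : Y ∪ Finset.image c {p, q, r} = insert (c r) (insert (c q) (insert (c p) Y)) := by
        rw [Finset.image_insert, Finset.image_insert, Finset.image_singleton]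
        clear * -
        grind
      rw [image_offDiag_triple c hpq hpr hqr, e1, Finset.union_comm, if_pos k,
        Finset.insert_union, Finset.insert_union, Finset.singleton_union]
      exact h'
  · obtain ⟨p, rfl⟩ := Finset.card_eq_one.1 h1
    obtain ⟨u, hu⟩ := hA1 p (by simp)
    have hpY := hA p (by simp)
    have hBc : B.card = 2 ∨ B.card = 3 := by omega
    rcases hBc with k | k
    · obtain ⟨q, hq⟩ := Finset.card_eq_one.1 (hsd.trans (by rw [k, h1]))
      obtain ⟨hqB, hqA⟩ := hsdA q (by rw [hq]; simp)
      have hpq : p ≠ q := fun h => hqA (by simp [h])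
      have hBeq : B = {p, q} := by rw [← hun, hq]; rfl
      refine ⟨b + 1, ?_, by simp [k]⟩
      have h' := h.pendant (c p) u (c q) hu (hB q hqB hqA)
      have e1 : Y ∪ Finset.image c {p, q} = insert (c q) Y := by
        rw [Finset.image_insert, Finset.image_singleton]
        clear * - hpY
        grind
      rw [if_neg (by omega), hBeq, image_offDiag_pair c hpq, e1, Finset.union_comm]
      exact h'
    · obtain ⟨q, r, hqr, hq⟩ := Finset.card_eq_two.1 (hsd.trans (by rw [k, h1]))
      obtain ⟨hqB, hqA⟩ := hsdA q (by rw [hq]; simp)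
      obtain ⟨hrB, hrA⟩ := hsdA r (by rw [hq]; simp)
      have hpq : p ≠ q := fun h => hqA (by simp [h])
      have hpr : p ≠ r := fun h => hrA (by simp [h])
      have hBeq : B = {p, q, r} := by rw [← hun, hq]; rfl
      refine ⟨b + 1, ?_, by simp [k]⟩
      have k2 := hne hrB hqB hqr.symm
      have k3 := hB r hrB hrA
      have h' := (h.pendant (c p) u (c q) hu (hB q hqB hqA)).triangle (c p) (c q) (c r)
        (by simp) (hne (hAB.1 (by simp)) hqB hpq) (by simp [k2, k3])
      have e1 : Y ∪ Finset.image c {p, q, r} = insert (c r) (insert (c q) Y) := by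
        rw [Finset.image_insert, Finset.image_insert, Finset.image_singleton]
        clear * - hpY
        grind
      rw [if_pos k, hBeq, image_offDiag_triple c hpq hpr hqr, e1, Finset.union_comm,
        Finset.insert_union, Finset.insert_union, Finset.singleton_union]
      exact h'
  · obtain ⟨p, q, hpq, rfl⟩ := Finset.card_eq_two.1 h2
    have k : B.card = 3 := by omega
    obtain ⟨r, hr⟩ := Finset.card_eq_one.1 (hsd.trans (by rw [k, h2]))
    obtain ⟨hrB, hrA⟩ := hsdA r (by rw [hr]; simp)
    have hpr : p ≠ r := fun h => hrA (by simp [h])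
    have hqr : q ≠ r := fun h => hrA (by simp [h])
    have hBeq : B = {p, q, r} := by
      rw [← hun, hr, Finset.insert_union]
      rfl
    refine ⟨b, ?_, by rw [if_pos k, if_pos h2, if_neg (by omega)]⟩
    have hE := hA2 p (by simp) q (by simp) hpq
    have hpY := hA p (by simp)
    have hqY := hA q (by simp)
    have h' := h.triangle (c p) (c q) (c r) hE (hne (hAB.1 (by simp)) (hAB.1 (by simp)) hpq)
      (hB r hrB hrA)
    have e1 : Y ∪ Finset.image c {p, q, r} = insert (c r) Y := by
      rw [Finset.image_insert, Finset.image_insert, Finset.image_singleton]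
      clear * - hpY hqY
      grind
    have e2 : E ∪ {s(c p, c r), s(c q, c r), s(c p, c q)}
        = insert s(c p, c r) (insert s(c q, c r) E) := by
      clear * - hE
      ext e
      simp only [Finset.mem_union, Finset.mem_insert, Finset.mem_singleton]
      constructor
      · rintro (h | h | h | rfl) <;> tauto
      · tauto
    rw [if_pos k, hBeq, image_offDiag_triple c hpq hpr hqr, e1, e2]
    exact h'

end Attach

namespace FTree

section Copies

variable {U : Type*} [DecidableEq U] {F : SimpleGraph U} {τ : Type*} {T : SimpleGraph τ}
  (P : FTree F T)

theorem copy_inj {t t' : τ} {w w' : U} {hw : w ∈ P.onVertex t} {hw' : w' ∈ P.onVertex t'}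
    (h : P.copy t w hw = P.copy t' w' hw') : w = w' :=
  congrArg P.label h

theorem mem_left_of_mem_onEdge {s t : τ} (h : T.Adj s t) {w : U}
    (hw : w ∈ P.onEdge ⟨s(s, t), T.mem_edgeSet.2 h⟩) : w ∈ P.onVertex s :=
  (Finset.mem_inter.1 ((P.ssubset s t h).1 hw)).1

theorem mem_right_of_mem_onEdge {s t : τ} (h : T.Adj s t) {w : U}
    (hw : w ∈ P.onEdge ⟨s(s, t), T.mem_edgeSet.2 h⟩) : w ∈ P.onVertex t :=
  (Finset.mem_inter.1 ((P.ssubset s t h).1 hw)).2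

theorem copy_eq_of_mem_onEdge {s t : τ} (h : T.Adj s t) {w : U}
    (hw : w ∈ P.onEdge ⟨s(s, t), T.mem_edgeSet.2 h⟩) :
    P.copy s w (P.mem_left_of_mem_onEdge h hw) = P.copy t w (P.mem_right_of_mem_onEdge h hw) :=
  Quot.sound ⟨h, rfl, hw⟩

/-- Copies of `w` on the two sides of an edge `st` with `w ∉ φ(st)` are different: being a copy of
`w` on the side of `t` is invariant under the identifications. -/
theorem copy_ne_copy {s t : τ} (h : T.Adj s t) {w : U}
    (hwe : w ∉ P.onEdge ⟨s(s, t), T.mem_edgeSet.2 h⟩) (hw : w ∈ P.onVertex t) {s' : τ}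
    (hs' : (T.deleteEdges {s(s, t)}).Reachable s s') {w' : U} (hw' : w' ∈ P.onVertex s') :
    P.copy t w hw ≠ P.copy s' w' hw' := by
  set R := T.deleteEdges {s(s, t)} with hR
  intro heq
  let f : P.PreVertex → Prop := fun a => a.2.1 = w ∧ R.Reachable t a.1
  have hf : ∀ a b, P.Glue a b → f a = f b := by
    rintro a b ⟨hab, hlab, hmem⟩
    refine propext ?_
    by_cases haw : a.2.1 = w
    · have hadj : R.Adj a.1 b.1 := by
        rw [hR, SimpleGraph.deleteEdges_adj]
        refine ⟨hab, fun he => hwe ?_⟩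
        have he' : (⟨s(a.1, b.1), T.mem_edgeSet.2 hab⟩ : T.edgeSet)
            = ⟨s(s, t), T.mem_edgeSet.2 h⟩ := Subtype.ext he
        rw [← he', ← haw]
        exact hmem
      simp only [f, haw, ← hlab, true_and]
      exact ⟨fun hr => hr.trans hadj.reachable, fun hr => hr.trans hadj.symm.reachable⟩
    · simp only [f, haw, ← hlab, false_and]
  have h1 : Quot.lift f hf (P.copy t w hw) := ⟨rfl, SimpleGraph.Reachable.refl _⟩
  rw [heq] at h1
  have hbr := (SimpleGraph.isAcyclic_iff_forall_adj_isBridge.1 P.isTree.isAcyclic) h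
  rw [SimpleGraph.isBridge_iff] at hbr
  exact hbr (hs'.trans h1.2.symm)

end Copies

section Build

variable {τ : Type*} {T : SimpleGraph τ}

/-- The edges of `T` with both ends in `S`, as a graph on all vertices. -/
def within (T : SimpleGraph τ) (S : Finset τ) : SimpleGraph τ where
  Adj u v := T.Adj u v ∧ u ∈ S ∧ v ∈ S
  symm := ⟨fun _ _ h => ⟨h.1.symm, h.2.2, h.2.1⟩⟩
  loopless := ⟨fun _ h => h.1.ne rfl⟩

theorem within_mono {S S' : Finset τ} (h : S ⊆ S') : within T S ≤ within T S' :=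
  fun _ _ h' => ⟨h'.1, h h'.2.1, h h'.2.2⟩

theorem within_le_deleteEdges {S : Finset τ} {s t : τ} (ht : t ∉ S) :
    within T S ≤ T.deleteEdges {s(s, t)} := by
  intro u v h
  rw [SimpleGraph.deleteEdges_adj]
  refine ⟨h.1, fun he => ?_⟩
  rcases Sym2.eq_iff.1 he with ⟨-, rfl⟩ | ⟨rfl, -⟩
  exacts [ht h.2.2, ht h.2.1]

variable (P : FTree (⊤ : SimpleGraph (Fin 3)) T)

open Classical in
/-- The number of `t ∈ S` with `|φ(t)| = j`. -/
noncomputable def countVertex (S : Finset τ) (j : ℕ) : ℕ :=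
  (S.filter fun t => (P.onVertex t).card = j).card

open Classical in
theorem countVertex_insert {S : Finset τ} {t : τ} (ht : t ∉ S) (j : ℕ) :
    P.countVertex (insert t S) j
      = P.countVertex S j + if (P.onVertex t).card = j then 1 else 0 := by
  unfold countVertex
  rw [Finset.filter_insert]
  split_ifs
  · rw [Finset.card_insert_of_notMem (by simp [ht])]
  · rfl

open Classical in
/-- The map that sends `w ∈ φ(t)` to its copy in `J_t`, with the value `d` outside `φ(t)`. -/
noncomputable def copyMap (t : τ) (d : P.Vertex) (w : Fin 3) : P.Vertex :=
  if h : w ∈ P.onVertex t then P.copy t w h else d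

theorem copyMap_of_mem {t : τ} (d : P.Vertex) {w : Fin 3} (hw : w ∈ P.onVertex t) :
    P.copyMap t d w = P.copy t w hw := dif_pos hw

theorem injOn_copyMap (t : τ) (d : P.Vertex) : Set.InjOn (P.copyMap t d) (P.onVertex t) := by
  intro w hw w' hw' h
  rw [P.copyMap_of_mem d hw, P.copyMap_of_mem d hw'] at h
  exact P.copy_inj h

variable [Fintype τ]

open Classical in
/-- The vertices of `H(T, φ)` that are copies in some `J_t` with `t ∈ S`. -/
noncomputable def vertices (S : Finset τ) : Finset P.Vertex :=
  Finset.univ.filter fun a => ∃ t ∈ S, ∃ w hw, P.copy t w hw = a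

open Classical in
/-- The edges of `H(T, φ)` that come from some `J_t` with `t ∈ S`. -/
noncomputable def edges (S : Finset τ) : Finset (Sym2 P.Vertex) :=
  Finset.univ.filter fun e => ∃ t ∈ S, ∃ w w' hw hw', w ≠ w' ∧ s(P.copy t w hw, P.copy t w' hw') = e

/-- The number of edges `e` of `T` with both ends in `S` and `|φ(e)| = 2`. -/
noncomputable def countEdge (S : Finset τ) : ℕ :=
  {e : T.edgeSet | (∀ v ∈ e.1, v ∈ S) ∧ (P.onEdge e).card = 2}.ncard

variable {P}

theorem mem_vertices {S : Finset τ} {a : P.Vertex} :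
    a ∈ P.vertices S ↔ ∃ t ∈ S, ∃ w hw, P.copy t w hw = a := by
  simp [vertices]

theorem mem_edges {S : Finset τ} {e : Sym2 P.Vertex} :
    e ∈ P.edges S ↔
      ∃ t ∈ S, ∃ w w' hw hw', w ≠ w' ∧ s(P.copy t w hw, P.copy t w' hw') = e := by
  simp [edges]

variable (P)

open Classical in
theorem vertices_insert (S : Finset τ) (t : τ) (d : P.Vertex) :
    P.vertices (insert t S) = P.vertices S ∪ (P.onVertex t).image (P.copyMap t d) := by
  ext a
  rw [Finset.mem_union, mem_vertices, mem_vertices, Finset.mem_image]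
  constructor
  · rintro ⟨t', ht', w, hw, rfl⟩
    rcases Finset.mem_insert.1 ht' with rfl | ht'
    · exact Or.inr ⟨w, hw, P.copyMap_of_mem d hw⟩
    · exact Or.inl ⟨t', ht', w, hw, rfl⟩
  · rintro (⟨t', ht', w, hw, rfl⟩ | ⟨w, hw, rfl⟩)
    · exact ⟨t', Finset.mem_insert_of_mem ht', w, hw, rfl⟩
    · exact ⟨t, Finset.mem_insert_self _ _, w, hw, (P.copyMap_of_mem d hw).symm⟩

open Classical in
theorem edges_insert (S : Finset τ) (t : τ) (d : P.Vertex) :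
    P.edges (insert t S) = P.edges S
      ∪ (P.onVertex t).offDiag.image fun p => s(P.copyMap t d p.1, P.copyMap t d p.2) := by
  ext e
  rw [Finset.mem_union, mem_edges, mem_edges, Finset.mem_image]
  constructor
  · rintro ⟨t', ht', w, w', hw, hw', hne, rfl⟩
    rcases Finset.mem_insert.1 ht' with rfl | ht'
    · refine Or.inr ⟨(w, w'), Finset.mem_offDiag.2 ⟨hw, hw', hne⟩, ?_⟩
      rw [P.copyMap_of_mem d hw, P.copyMap_of_mem d hw']
    · exact Or.inl ⟨t', ht', w, w', hw, hw', hne, rfl⟩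
  · rintro (⟨t', ht', w, w', hw, hw', hne, rfl⟩ | ⟨⟨w, w'⟩, hp, rfl⟩)
    · exact ⟨t', Finset.mem_insert_of_mem ht', w, w', hw, hw', hne, rfl⟩
    · obtain ⟨hw, hw', hne⟩ := Finset.mem_offDiag.1 hp
      refine ⟨t, Finset.mem_insert_self _ _, w, w', hw, hw', hne, ?_⟩
      rw [P.copyMap_of_mem d hw, P.copyMap_of_mem d hw']

open Classical in
theorem countEdge_insert {S : Finset τ} {s t : τ} (hs : s ∈ S) (ht : t ∉ S) (h : T.Adj s t)
    (huniq : ∀ s' ∈ S, T.Adj s' t → s' = s) :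
    P.countEdge (insert t S) = P.countEdge S
      + if (P.onEdge ⟨s(s, t), T.mem_edgeSet.2 h⟩).card = 2 then 1 else 0 := by
  unfold countEdge
  have key : ∀ e : T.edgeSet, (∀ v ∈ e.1, v ∈ insert t S) ↔
      (∀ v ∈ e.1, v ∈ S) ∨ e = ⟨s(s, t), T.mem_edgeSet.2 h⟩ := by
    rintro ⟨e, he⟩
    induction e with
    | _ u v =>
    have huv : T.Adj u v := he
    simp only [Sym2.mem_iff, forall_eq_or_imp, forall_eq, Finset.mem_insert, Subtype.mk.injEq]
    constructor
    · rintro ⟨rfl | hu, rfl | hv⟩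
      · exact absurd rfl huv.ne
      · exact Or.inr (by rw [huniq v hv huv.symm, Sym2.eq_swap])
      · exact Or.inr (by rw [huniq u hu huv])
      · exact Or.inl ⟨hu, hv⟩
    · rintro (⟨hu, hv⟩ | he)
      · exact ⟨Or.inr hu, Or.inr hv⟩
      · rcases Sym2.eq_iff.1 he with ⟨rfl, rfl⟩ | ⟨rfl, rfl⟩
        exacts [⟨Or.inr hs, Or.inl rfl⟩, ⟨Or.inl rfl, Or.inr hs⟩]
  split_ifs with h2
  · rw [← Set.ncard_insert_of_notMem (a := (⟨s(s, t), T.mem_edgeSet.2 h⟩ : T.edgeSet))]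
    · congr 1
      ext e
      simp only [Set.mem_ofPred_eq, Set.mem_insert_iff, key]
      constructor
      · rintro ⟨h1 | h1, h3⟩
        exacts [Or.inr ⟨h1, h3⟩, Or.inl h1]
      · rintro (rfl | ⟨h1, h3⟩)
        exacts [⟨Or.inr rfl, h2⟩, ⟨Or.inl h1, h3⟩]
    · rintro ⟨h1, -⟩
      exact ht (h1 t (Sym2.mem_mk_right _ _))
  · rw [add_zero]
    congr 1
    ext e
    simp only [Set.mem_ofPred_eq, key]
    constructor
    · rintro ⟨h1 | rfl, h3⟩
      exacts [⟨h1, h3⟩, absurd h3 h2]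
    · rintro ⟨h1, h3⟩
      exact ⟨Or.inl h1, h3⟩

open Classical in
/-- The part of `H(T, φ)` over a suitable subtree of `T` with `n + 1` vertices is a built graph. -/
theorem exists_builtGraph_subtree (n : ℕ) (hn : n + 1 ≤ Fintype.card τ) :
    ∃ S : Finset τ, S.card = n + 1 ∧ (∀ u ∈ S, ∀ v ∈ S, (within T S).Reachable u v) ∧
      ∃ b, BuiltGraph (P.vertices S) (P.edges S) (P.countVertex S 3) b ∧
        b + P.countEdge S = P.countVertex S 3 + P.countVertex S 2 := by
  induction n with
  | zero =>
    obtain ⟨r⟩ := P.isTree.connected.nonempty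
    have hce : P.countEdge {r} = 0 := by
      unfold countEdge
      rw [Set.ncard_eq_zero]
      ext ⟨e, he⟩
      induction e with
      | _ u v =>
      have huv : T.Adj u v := he
      simp only [Set.mem_ofPred_eq, Set.mem_empty_iff_false, iff_false, Sym2.mem_iff,
        forall_eq_or_imp, forall_eq, Finset.mem_singleton]
      rintro ⟨⟨rfl, rfl⟩, -⟩
      exact huv.ne rfl
    have hV0 : P.vertices ∅ = ∅ := by simp [vertices]
    have hE0 : P.edges ∅ = ∅ := by simp [edges]
    have hcv : ∀ j, P.countVertex {r} j = if (P.onVertex r).card = j then 1 else 0 := by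
      intro j
      have := P.countVertex_insert (Finset.notMem_empty r) j
      simpa [countVertex] using this
    refine ⟨{r}, rfl, ?_, ?_⟩
    · intro u hu v hv
      rw [Finset.mem_singleton.1 hu, Finset.mem_singleton.1 hv]
    rcases (P.onVertex r).eq_empty_or_nonempty with h0 | ⟨w, hw⟩
    · refine ⟨0, ?_, by simp [hce, hcv, h0]⟩
      have e1 : P.vertices {r} = ∅ := by
        ext a
        simp [mem_vertices, h0]
      have e2 : P.edges {r} = ∅ := by
        ext a
        simp [mem_edges, h0]
      rw [e1, e2, hcv, h0]
      exact BuiltGraph.empty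
    · have h := BuiltGraph.empty.attach (A := ∅) (B := P.onVertex r)
        (Finset.empty_ssubset.2 ⟨w, hw⟩) (P.copyMap r (P.copy r w hw)) (P.injOn_copyMap _ _)
        (by simp) (by simp) (by simp) (by simp)
      obtain ⟨b, hb, hbe⟩ := h
      have e1 := P.vertices_insert ∅ r (P.copy r w hw)
      have e2 := P.edges_insert ∅ r (P.copy r w hw)
      rw [hV0] at e1
      rw [hE0] at e2
      rw [← e1, ← e2] at hb
      refine ⟨b, ?_, ?_⟩
      · rw [hcv]
        simpa using hb
      · rw [hce, hcv, hcv]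
        simpa using hbe
  | succ n ih =>
    obtain ⟨S, hcard, hreach, b, hb, hbe⟩ := ih (by omega)
    obtain ⟨s₀, hs₀⟩ : S.Nonempty := Finset.card_pos.1 (by omega)
    obtain ⟨t₀, ht₀⟩ : ∃ t, t ∉ S := by
      by_contra! hall
      rw [Finset.eq_univ_iff_forall.2 hall, Finset.card_univ] at hcard
      omega
    -- A path that leaves `S` does so along an edge `st` of `T`; the new vertex is `t`.
    obtain ⟨p⟩ := P.isTree.connected.preconnected s₀ t₀
    obtain ⟨d, -, hds, hdt⟩ := p.exists_boundary_dart (S : Set τ) hs₀ ht₀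
    set s := d.fst
    set t := d.snd
    have hst : T.Adj s t := d.adj
    have hs : s ∈ S := hds
    have ht : t ∉ S := hdt
    have hdel : ∀ s' ∈ S, (T.deleteEdges {s(s, t)}).Reachable s s' := fun s' hs' =>
      (hreach s hs s' hs').mono (within_le_deleteEdges ht)
    have hbr := (SimpleGraph.isAcyclic_iff_forall_adj_isBridge.1 P.isTree.isAcyclic) hst
    rw [SimpleGraph.isBridge_iff] at hbr
    have huniq : ∀ s' ∈ S, T.Adj s' t → s' = s := by
      intro s' hs' hadj
      by_contra hne
      refine hbr ((hdel s' hs').trans (SimpleGraph.Adj.reachable ?_))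
      rw [SimpleGraph.deleteEdges_adj]
      refine ⟨hadj, fun he => ?_⟩
      rcases Sym2.eq_iff.1 he with ⟨h, -⟩ | ⟨h, -⟩
      · exact hne h
      · exact ht (h ▸ hs')
    set A := P.onEdge ⟨s(s, t), T.mem_edgeSet.2 hst⟩ with hA
    have hAs := P.ssubset s t hst
    have hAt : A ⊂ P.onVertex t := hAs.trans_subset Finset.inter_subset_right
    have hAs' : A ⊂ P.onVertex s := hAs.trans_subset Finset.inter_subset_left
    obtain ⟨w₀, hw₀, -⟩ := Finset.exists_of_ssubset hAt
    set c := P.copyMap t (P.copy t w₀ hw₀) with hc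
    have hcA : ∀ w (hw : w ∈ A), c w = P.copy s w (hAs'.1 hw) := by
      intro w hw
      rw [hc, P.copyMap_of_mem _ (hAt.1 hw)]
      exact (P.copy_eq_of_mem_onEdge hst hw).symm
    obtain ⟨b', hb', hbe'⟩ := hb.attach hAt c (P.injOn_copyMap _ _)
      (fun w hw => by
        rw [hcA w hw, mem_vertices]
        exact ⟨s, hs, w, _, rfl⟩)
      (fun w hw hwA hmem => by
        rw [hc, P.copyMap_of_mem _ hw, mem_vertices] at hmem
        obtain ⟨s', hs', w', hw', he⟩ := hmem
        exact P.copy_ne_copy hst hwA hw (hdel s' hs') hw' he.symm)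
      -- As `φ(st)` is a proper subset of `φ(s)`, its elements have neighbours in `J_s`.
      (fun w hw => by
        obtain ⟨w', hw', hne⟩ := Finset.exists_of_ssubset hAs'
        refine ⟨P.copy s w' hw', ?_⟩
        rw [hcA w hw, mem_edges]
        exact ⟨s, hs, w, w', _, _, fun h => hne (h ▸ hw), rfl⟩)
      (fun w hw w' hw' hne => by
        rw [hcA w hw, hcA w' hw', mem_edges]
        exact ⟨s, hs, w, w', _, _, hne, rfl⟩)
    refine ⟨insert t S, by rw [Finset.card_insert_of_notMem ht, hcard], ?_, b', ?_, ?_⟩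
    · have hts : (within T (insert t S)).Reachable t s :=
        SimpleGraph.Adj.reachable ⟨hst.symm, by simp, by simp [hs]⟩
      have hto : ∀ u ∈ insert t S, (within T (insert t S)).Reachable u s := by
        intro u hu
        rcases Finset.mem_insert.1 hu with rfl | hu
        · exact hts
        · exact (hreach u hu s hs).mono (within_mono (Finset.subset_insert _ _))
      exact fun u hu v hv => (hto u hu).trans (hto v hv).symm
    · rw [P.vertices_insert S t (P.copy t w₀ hw₀), P.edges_insert S t (P.copy t w₀ hw₀),
        P.countVertex_insert ht]
      exact hb'
    · rw [P.countVertex_insert ht, P.countVertex_insert ht, P.countEdge_insert hs ht hst huniq,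
        ← hA]
      omega

open Classical in
/-- The graph `H(T, φ)` is built with `v₃` triangles and `v₃ + v₂ - e₂` isolated or pendant
edges. -/
theorem exists_builtGraph : ∃ b,
    BuiltGraph Finset.univ P.graph.edgeFinset (P.numVertex 3) b ∧
      b + P.numEdge 2 = P.numVertex 3 + P.numVertex 2 := by
  have hpos : 0 < Fintype.card τ := Fintype.card_pos_iff.2 P.isTree.connected.nonempty
  obtain ⟨S, hS, -, b, hb, hbe⟩ := P.exists_builtGraph_subtree (Fintype.card τ - 1) (by omega)
  have hSu : S = Finset.univ := Finset.card_eq_iff_eq_univ S |>.1 (by omega)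
  subst hSu
  have e1 : P.vertices Finset.univ = Finset.univ := by
    ext a
    simp only [mem_vertices, Finset.mem_univ, true_and, iff_true]
    induction a using Quot.ind with
    | mk a => exact ⟨a.1, a.2.1, a.2.2, rfl⟩
  have e2 : P.edges Finset.univ = P.graph.edgeFinset := by
    ext e
    rw [mem_edges, SimpleGraph.mem_edgeFinset]
    constructor
    · rintro ⟨t, -, w, w', hw, hw', hne, rfl⟩
      exact ⟨t, w, w', hw, hw', hne, rfl, rfl⟩
    · induction e with
      | _ x y =>
      rintro ⟨t, w, w', hw, hw', hne, rfl, rfl⟩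
      exact ⟨t, Finset.mem_univ _, w, w', hw, hw', hne, rfl⟩
  have e3 : ∀ j, P.countVertex Finset.univ j = P.numVertex j := by
    intro j
    unfold countVertex numVertex
    rw [← Set.ncard_coe_finset]
    congr 1
    ext t
    simp
  have e4 : P.countEdge Finset.univ = P.numEdge 2 := by
    unfold countEdge numEdge
    simp
  rw [e1, e2, e3] at hb
  rw [e3, e3, e4] at hbe
  exact ⟨b, hb, hbe⟩

end Build

end FTree

/-! ### Homomorphism densities and commonness -/

section HomDensity

variable {V V' : Type*} [Fintype V] [Fintype V']

theorem homDensity_eq_of_coe_eq (H : SimpleGraph V) (W : Graphon) (E : Finset (Sym2 V))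
    (hE : (E : Set (Sym2 V)) = H.edgeSet) :
    homDensity H W = ∫ x : V → unitInterval, ∏ e ∈ E, W.onPair (e.map x) := by
  classical
  have : E = H.edgeFinset := by
    rw [← Finset.coe_inj, hE, SimpleGraph.coe_edgeFinset]
  subst this
  unfold homDensity
  congr! 3

theorem homDensity_nonneg (H : SimpleGraph V) (W : Graphon) : 0 ≤ homDensity H W :=
  integral_nonneg fun _ => Finset.prod_nonneg fun _ _ => W.onPair_nonneg _

theorem homDensity_top_fin_two (W : Graphon) :
    homDensity (⊤ : SimpleGraph (Fin 2)) W = W.edgeDensity := by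
  rw [W.edgeDensity_eq_integral_prod]
  refine homDensity_eq_of_coe_eq _ _ _ ?_
  ext e
  induction e with
  | _ a b => fin_cases a <;> fin_cases b <;> simp

theorem edgeSet_sum {V V' : Type*} (G : SimpleGraph V) (H : SimpleGraph V') :
    (G ⊕g H).edgeSet = Sym2.map Sum.inl '' G.edgeSet ∪ Sym2.map Sum.inr '' H.edgeSet := by
  ext e
  constructor
  · induction e with
    | _ a b =>
    rcases a with a | a <;> rcases b with b | b <;> intro h
    · exact Or.inl ⟨s(a, b), (SimpleGraph.sum_adj_inl (G := G) (H := H)).1 h, rfl⟩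
    · exact absurd h (by simp)
    · exact absurd h (by simp)
    · exact Or.inr ⟨s(a, b), (SimpleGraph.sum_adj_inr (G := G) (H := H)).1 h, rfl⟩
  · rintro (⟨e, he, rfl⟩ | ⟨e, he, rfl⟩)
    · induction e with
      | _ a b => exact (SimpleGraph.sum_adj_inl (G := G) (H := H)).2 he
    · induction e with
      | _ a b => exact (SimpleGraph.sum_adj_inr (G := G) (H := H)).2 he

theorem map_inl_ne_map_inr {V V' : Type*} (e : Sym2 V) (e' : Sym2 V') :
    e.map (Sum.inl : V → V ⊕ V') ≠ e'.map Sum.inr := by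
  induction e with
  | _ a b =>
  induction e' with
  | _ c d => simp

theorem numEdges_sum (G : SimpleGraph V) (H : SimpleGraph V') :
    numEdges (G ⊕g H) = numEdges G + numEdges H := by
  unfold numEdges
  rw [edgeSet_sum, Set.ncard_union_eq,
    Set.ncard_image_of_injective _ (Sym2.map.injective Sum.inl_injective),
    Set.ncard_image_of_injective _ (Sym2.map.injective Sum.inr_injective)]
  rw [Set.disjoint_left]
  rintro _ ⟨e, -, rfl⟩ ⟨e', -, h⟩
  exact map_inl_ne_map_inr e e' h.symm

/-- Homomorphism densities are multiplicative over disjoint unions. -/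
theorem homDensity_sum (G : SimpleGraph V) (H : SimpleGraph V') (W : Graphon) :
    homDensity (G ⊕g H) W = homDensity G W * homDensity H W := by
  classical
  rw [homDensity_eq_of_coe_eq (G ⊕g H) W
    (G.edgeFinset.image (Sym2.map Sum.inl) ∪ H.edgeFinset.image (Sym2.map Sum.inr))
    (by simp [edgeSet_sum]), homDensity_eq_of_coe_eq G W G.edgeFinset (by simp),
    homDensity_eq_of_coe_eq H W H.edgeFinset (by simp)]
  have hdisj : Disjoint (G.edgeFinset.image (Sym2.map (Sum.inl : V → V ⊕ V')))
      (H.edgeFinset.image (Sym2.map Sum.inr)) := by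
    rw [Finset.disjoint_left]
    intro e he he'
    obtain ⟨e₁, -, rfl⟩ := Finset.mem_image.1 he
    obtain ⟨e₂, -, h⟩ := Finset.mem_image.1 he'
    exact map_inl_ne_map_inr e₁ e₂ h.symm
  have hmp := volume_measurePreserving_sumPiEquivProdPi fun _ : V ⊕ V' => unitInterval
  rw [← integral_prod_mul, ← Measure.volume_eq_prod,
    ← hmp.integral_comp' (g := fun z : (V → unitInterval) × (V' → unitInterval) =>
      (∏ e ∈ G.edgeFinset, W.onPair (e.map z.1)) * ∏ e ∈ H.edgeFinset, W.onPair (e.map z.2))]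
  congr 1 with x
  rw [Finset.prod_union hdisj,
    Finset.prod_image (Sym2.map.injective Sum.inl_injective).injOn,
    Finset.prod_image (Sym2.map.injective Sum.inr_injective).injOn]
  simp only [Sym2.map_map]
  rfl

/-- The constant graphon `1 / 2`. -/
noncomputable def halfGraphon : Graphon where
  toFun _ _ := 1 / 2
  measurable' := measurable_const
  symm' _ _ := rfl
  nonneg' _ _ := by norm_num
  le_one' _ _ := by norm_num

theorem homDensity_halfGraphon (H : SimpleGraph V) :
    homDensity H halfGraphon = (1 / 2) ^ numEdges H := by
  classical
  rw [homDensity_eq_of_coe_eq H _ H.edgeFinset (by simp)]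
  have : ∀ e : Sym2 unitInterval, halfGraphon.onPair e = 1 / 2 := by
    intro e
    induction e with
    | _ a b => rfl
  simp only [this, Finset.prod_const]
  rw [numEdges, ← SimpleGraph.coe_edgeFinset, Set.ncard_coe_finset]
  simp

/-- The bound is attained by the constant graphon `1 / 2`, so that only the lower bound is to be
shown. -/
theorem isCommon_of_forall_le (H : SimpleGraph V)
    (h : ∀ W : Graphon, 2 * (1 / 2 : ℝ) ^ numEdges H ≤ homDensity H W + homDensity H W.compl) :
    IsCommon H := by
  have : Nonempty Graphon := ⟨halfGraphon⟩
  refine le_antisymm ?_ (le_ciInf h)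
  refine (ciInf_le ⟨_, Set.forall_mem_range.2 h⟩ halfGraphon).trans_eq ?_
  have hc : halfGraphon.compl = halfGraphon := by
    simp only [Graphon.compl, halfGraphon]
    congr 1
    ext x y
    norm_num
  rw [hc, homDensity_halfGraphon]
  ring

end HomDensity

/-- The lower bound on `t(H ⊔ F, W)` from those on its factors `tH` and `tF`. -/
theorem pow_mul_zpow_le {x p tH tF : ℝ} {k j f : ℕ} (hp : 0 < p) (htH : 0 ≤ tH)
    (hH : x ^ k ≤ tH * p ^ j) (hF : p ^ f ≤ tF) :
    x ^ k * p ^ ((f : ℤ) - j) ≤ tH * tF := by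
  calc x ^ k * p ^ ((f : ℤ) - j) ≤ tH * p ^ j * p ^ ((f : ℤ) - j) := by gcongr
    _ = tH * p ^ f := by
      rw [mul_assoc, ← zpow_natCast p j, ← zpow_add₀ hp.ne', add_sub_cancel, zpow_natCast]
    _ ≤ tH * tF := by gcongr

/-- Normalization by the densities `1 / 8` and `1 / 2` of a triangle and an edge in the constant
graphon `1 / 2`. -/
theorem half_pow_mul_eq {x p : ℝ} {k : ℕ} {m : ℤ} :
    x ^ k * p ^ m = (1 / 2) ^ (3 * k + m) * ((8 * x) ^ k * (2 * p) ^ m) := by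
  rw [mul_pow, mul_zpow, zpow_add₀ (by norm_num), zpow_mul]
  have h1 : ((1 / 2 : ℝ) ^ (3 : ℤ)) ^ (k : ℤ) * 8 ^ k = 1 := by
    rw [zpow_natCast, ← mul_pow]
    norm_num
  have h2 : (1 / 2 : ℝ) ^ m * 2 ^ m = 1 := by
    rw [← mul_zpow]
    norm_num
  linear_combination (-(x ^ k * p ^ m)) * h1 - (x ^ k * p ^ m)
    * ((1 / 2 : ℝ) ^ (3 : ℤ)) ^ (k : ℤ) * 8 ^ k * h2

theorem mainTheorem8 {τ : Type*} [Fintype τ] (T : SimpleGraph τ)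
    (P : FTree (⊤ : SimpleGraph (Fin 3)) T)
    {V : Type*} [Fintype V] (F : SimpleGraph V) (hF : IsSidorenko F)
    (he : P.numVertex 2 ≤ P.numEdge 2) :
    (∀ k : ℕ, 3 ≤ k → P.numVertex 3 = k →
      (numEdges F : ℝ) ≤ 5 * (k : ℝ) / 3 + (P.numEdge 2 : ℝ) - (P.numVertex 2 : ℝ) →
      IsCommon (P.graph ⊕g F)) ∧
    (P.numVertex 3 = 2 →
      (numEdges F : ℝ) ≤ 2 + (P.numEdge 2 : ℝ) - (P.numVertex 2 : ℝ) →
      IsCommon (P.graph ⊕g F)) := by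
  classical
  obtain ⟨b, hb, hbe⟩ := P.exists_builtGraph
  obtain ⟨k, hk⟩ : ∃ k, P.numVertex 3 = k := ⟨_, rfl⟩
  rw [hk] at hb hbe
  have hbk : b ≤ k := by omega
  set f := numEdges F with hf
  -- The exponent that is left of the edge density, after that of the lower bound for `H`.
  obtain ⟨m, hm⟩ : ∃ m : ℤ, m = f - (k - b : ℕ) := ⟨_, rfl⟩
  have hmk : -(k : ℤ) ≤ m := by omega
  have hnum : numEdges (P.graph ⊕g F) = 2 * k + b + f := by
    rw [numEdges_sum, ← hb.card_edges, numEdges, ← SimpleGraph.coe_edgeFinset,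
      Set.ncard_coe_finset]
  have hexp : ((2 * k + b + f : ℕ) : ℤ) = 3 * k + m := by omega
  have hlow : ∀ W : Graphon, 0 < W.edgeDensity →
      (1 / 2) ^ (3 * k + m) * ((8 * W.triangleDensity) ^ k * (2 * W.edgeDensity) ^ m)
        ≤ homDensity (P.graph ⊕g F) W := by
    intro W hp
    rw [homDensity_sum, ← half_pow_mul_eq, hm]
    refine pow_mul_zpow_le hp (homDensity_nonneg _ _) ?_ ?_
    · rw [homDensity_eq_of_coe_eq P.graph W _ (SimpleGraph.coe_edgeFinset _)]
      exact W.triangleDensity_pow_le hb hbk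
    · rw [← homDensity_top_fin_two]
      exact hF.2 W
  -- It suffices to treat the graphons of edge density at least `1 / 2`.
  have main : (∀ A B u : ℝ, 0 ≤ A → 0 ≤ B → 0 ≤ u → u < 1 → 2 + 6 * u ^ 2 ≤ A + B →
        16 * u / 3 ≤ A → 2 ≤ A ^ k * (1 + u) ^ m + B ^ k * (1 - u) ^ m) → 2 ≤ k →
      IsCommon (P.graph ⊕g F) := by
    intro hopt hk2
    have key : ∀ W : Graphon, 1 / 2 ≤ W.edgeDensity → 2 * (1 / 2 : ℝ) ^ numEdges (P.graph ⊕g F)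
        ≤ homDensity (P.graph ⊕g F) W + homDensity (P.graph ⊕g F) W.compl := by
      intro W hW
      have hc := W.edgeDensity_compl
      have hc0 := W.compl.edgeDensity_nonneg
      have h1 := hlow W (by linarith)
      have hbol := W.bollobas
      have hgood := W.goodman
      rw [hnum, ← zpow_natCast, hexp]
      have hpos : (0 : ℝ) < (1 / 2) ^ (3 * k + m) := by positivity
      rcases hc0.eq_or_lt with h0 | h0
      · -- A negative power of the edge density of `1 - W` would be a junk value here, but the
        -- densities in `W` suffice.
        have hp1 : W.edgeDensity = 1 := by linarith
        rw [hp1, mul_one] at h1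
        have := two_le_pow_of_eq_one (A := 8 * W.triangleDensity) (by linarith) hk2 hmk
        have := mul_le_mul_of_nonneg_left this hpos.le
        linarith [homDensity_nonneg (P.graph ⊕g F) W.compl]
      · have h2 := hlow W.compl h0
        have h3 := hopt (8 * W.triangleDensity) (8 * W.compl.triangleDensity)
          (2 * W.edgeDensity - 1) (by linarith [W.triangleDensity_nonneg])
          (by linarith [W.compl.triangleDensity_nonneg]) (by linarith) (by linarith)
          (by linarith) (by linarith)
        rw [show 1 + (2 * W.edgeDensity - 1) = 2 * W.edgeDensity by ring,
          show 1 - (2 * W.edgeDensity - 1) = 2 * W.compl.edgeDensity by rw [hc]; ring] at h3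
        have := mul_le_mul_of_nonneg_left h3 hpos.le
        linarith
    refine isCommon_of_forall_le _ fun W => ?_
    rcases le_total (1 / 2) W.edgeDensity with h | h
    · exact key W h
    · have := key W.compl (by rw [W.edgeDensity_compl]; linarith)
      rw [W.compl_compl] at this
      linarith
  have hmR : (m : ℝ) = f + P.numVertex 2 - P.numEdge 2 := by
    have : m = f + P.numVertex 2 - P.numEdge 2 := by omega
    rw [this]
    push_cast
    ring
  have hmkR : -(k : ℝ) ≤ m := by exact_mod_cast hmk
  constructor
  · intro k' hk3 hk' hle
    obtain rfl : k = k' := hk.symm.trans hk'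
    exact main (fun A B u hA hB hu0 hu1 hAB hAL =>
      two_le_pow_sum_of_three_le hA hB hu0 hu1 hAB hAL hk3 hmkR (by linarith)) (by omega)
  · intro hk2 hle
    obtain rfl : k = 2 := hk.symm.trans hk2
    have hm2 : m ≤ 2 := by
      have : (m : ℝ) ≤ 2 := by linarith
      exact_mod_cast this
    exact main (fun A B u _ _ hu0 hu1 hAB hAL =>
      two_le_sq_sum hu0 hu1 hAB hAL (by exact_mod_cast hmk) hm2) le_rfl
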